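/- Let $d\ge 1$, let $\Omega\subset\mathbb R^d$ be open with Lipschitz boundary (near every boundary point, in suitable orthonormal coordinates, $\Omega$ is the part strictly above the graph of a Lipschitz function), let $\theta\in[0,\frac{\pi}{2})$ and $p\in(1,\infty)$. Let $c_{kl}\in W^{1,\infty}(\Omega,\mathbb C)$ for $k,l\in\{1,\dots,d\}$ and $C=(c_{kl})$. Assume $$(C(x)\xi,\xi)\in\Sigma_\theta:=\{re^{i\beta}: r\ge 0,\ |\beta|\le\theta\}\qquad\text{for almost every }x\in\Omega\text{ and all }\xi\in\mathbb C^d .$$ Write $C=R+iB$ with $R,B$ real matrices, and let $R_a=\frac12(R-R^T)$ and $B_a=\frac12(B-B^T)$. Let $$A_pu=-\sum_{k,l=1}^d\partial_l(c_{kl}\,\partial_ku),\qquad D(A_p)=W^{2,p}(\Omega)\cap W^{1,p}_0(\Omega),$$ with weak derivatives, and let $(f,v)=\int_\Omega f\,\overline v$. Suppose $|1-\frac2p|<\cos\theta$ and $B_a=0$ almost everywhere on $\Omega$, and put $\phi=\arccos|1-\frac2p|$. Then, for every $u\in D(A_p)$, $A_pu$ is well defined as an element of $L_p(\Omega)$,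 the function $(A_pu)\,|u|^{p-2}\,\overline u\,\mathbf 1_{[u\ne0]}$ is integrable over $\Omega$, and $$\bigl|\operatorname{Im}\bigl(A_pu,\ |u|^{p-2}u\,\mathbf 1_{[u\neq0]}\bigr)\bigr|\le K\,\operatorname{Re}\bigl(A_pu,\ |u|^{p-2}u\,\mathbf 1_{[u\neq0]}\bigr),$$ where $$K=\begin{cases}\tan\bigl(\frac{\pi}{2}-\phi+\theta\bigr) & \text{if } R_a=0 \text{ almost everywhere on }\Omega,\\[1ex] \dfrac{\bigl(\frac{2}{\sin\phi}-1\bigr)\tan\theta+\cot\phi}{1-(\tan\theta)\cot\phi} & \text{otherwise.}\end{cases}$$ -/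

import Mathlib

open MeasureTheory TopologicalSpace
open scoped ENNReal Distributions

noncomputable section

/-- `ℝ^d` with its Euclidean norm. -/
abbrev RSpace (d : ℕ) : Type := EuclideanSpace ℝ (Fin d)

/-- The restriction of Lebesgue measure to the open set `Ω`. -/
abbrev lebOn {d : ℕ} (Ω : Opens (RSpace d)) : Measure (RSpace d) :=
  volume.restrict (Ω : Set (RSpace d))

/-- The `j`-th classical partial derivative of `φ` at `x`. -/
def partialDeriv {d : ℕ} {F : Type*} [NormedAddCommGroup F] [NormedSpace ℝ F]
    (j : Fin d) (φ : RSpace d → F) (x : RSpace d) : F :=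
  fderiv ℝ φ x (EuclideanSpace.single j (1 : ℝ))

/-- `Ω` has Lipschitz boundary: near every boundary point, `Ω` is the part strictly above the
graph of a Lipschitz function, where "above" refers to some unit vector `e`, and the function is
evaluated at the component `y - ⟪e, y⟫ e` of `y` orthogonal to `e`. -/
def HasLipschitzBoundary {d : ℕ} (Ω : Opens (RSpace d)) : Prop :=
  ∀ x ∈ frontier (Ω : Set (RSpace d)),
    ∃ (e : RSpace d) (γ : RSpace d → ℝ) (L : NNReal) (r : ℝ),
      ‖e‖ = 1 ∧ LipschitzWith L γ ∧ 0 < r ∧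
        ∀ y ∈ Metric.ball x r,
          (y ∈ Ω ↔ γ (y - (inner ℝ e y : ℝ) • e) < inner ℝ e y)

/-- `g` is the `j`-th weak (distributional) partial derivative of `f` on `Ω`; both are locally
integrable on `Ω`, and `φ` runs through the real-valued `C_c^∞(Ω)`. -/
def IsWeakPartial {d : ℕ} (Ω : Opens (RSpace d)) (j : Fin d) (f g : RSpace d → ℂ) : Prop :=
  LocallyIntegrableOn f (Ω : Set (RSpace d)) volume ∧
  LocallyIntegrableOn g (Ω : Set (RSpace d)) volume ∧
  ∀ φ : 𝓓(Ω, ℝ),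
    ∫ x, partialDeriv j φ x • f x ∂(lebOn Ω) = - ∫ x, φ x • g x ∂(lebOn Ω)

/-- `f ∈ W^{m,q}(Ω)`: `f` and all its weak derivatives up to order `m` lie in `L_q(Ω)`. -/
def MemW {d : ℕ} (Ω : Opens (RSpace d)) (q : ℝ≥0∞) : ℕ → (RSpace d → ℂ) → Prop
  | 0, f => MemLp f q (lebOn Ω)
  | m + 1, f => MemLp f q (lebOn Ω) ∧
      ∀ j : Fin d, ∃ g : RSpace d → ℂ, IsWeakPartial Ω j f g ∧ MemW Ω q m g

/-- `f ∈ W^{1,q}_0(Ω)`: `f` is in the closure of `C_c^∞(Ω)` in `W^{1,q}(Ω)`. -/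
def MemW10 {d : ℕ} (Ω : Opens (RSpace d)) (q : ℝ≥0∞) (f : RSpace d → ℂ) : Prop :=
  MemW Ω q 1 f ∧
  ∀ ε : ℝ≥0∞, 0 < ε → ∃ φ : 𝓓(Ω, ℂ),
    eLpNorm (fun x => f x - φ x) q (lebOn Ω) ≤ ε ∧
    ∀ (j : Fin d) (g : RSpace d → ℂ), IsWeakPartial Ω j f g →
      eLpNorm (fun x => g x - partialDeriv j φ x) q (lebOn Ω) ≤ ε

/-- The closed sector `Σ_θ = {r e^{iβ} : r ≥ 0, |β| ≤ θ}` in the complex plane. -/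
def complexSector (θ : ℝ) : Set ℂ :=
  {z | ∃ r β : ℝ, 0 ≤ r ∧ |β| ≤ θ ∧ z = (r : ℂ) * Complex.exp (Complex.I * (β : ℂ))}

/-- The form `(M ξ, ξ) = ∑_{k,l} M_{kl} ξ_l conj(ξ_k)`, the inner product of `ℂ^d` being linear
in its first argument. -/
def matrixForm {d : ℕ} (M : Matrix (Fin d) (Fin d) ℂ) (ξ : Fin d → ℂ) : ℂ :=
  ∑ k, (M.mulVec ξ) k * (starRingEnd ℂ) (ξ k)

/-- The anti-symmetric part `(M - Mᵀ) / 2` of a real matrix. -/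
def antisymmPart {d : ℕ} (M : Matrix (Fin d) (Fin d) ℝ) : Matrix (Fin d) (Fin d) ℝ :=
  (2⁻¹ : ℝ) • (M - M.transpose)

/-- `R_a = (R - Rᵀ) / 2` for `M = R + i B` with `R`, `B` real. -/
def reAntisymm {d : ℕ} (M : Matrix (Fin d) (Fin d) ℂ) : Matrix (Fin d) (Fin d) ℝ :=
  antisymmPart (M.map Complex.re)

/-- `B_a = (B - Bᵀ) / 2` for `M = R + i B` with `R`, `B` real. -/
def imAntisymm {d : ℕ} (M : Matrix (Fin d) (Fin d) ℂ) : Matrix (Fin d) (Fin d) ℝ :=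
  antisymmPart (M.map Complex.im)

/-- `u ∈ D(A_p) = W^{2,p}(Ω) ∩ W^{1,p}_0(Ω)`. -/
def MemDomain {d : ℕ} (Ω : Opens (RSpace d)) (p : ℝ) (u : RSpace d → ℂ) : Prop :=
  MemW Ω (ENNReal.ofReal p) 2 u ∧ MemW10 Ω (ENNReal.ofReal p) u

/-- `u ∈ D(A_p)` and `f` is (a representative of) `A_p u = - ∑_{k,l} ∂_l (c_{kl} ∂_k u)` in
`L_p(Ω)`: here `g k = ∂_k u` and `h k l = ∂_l (c_{kl} ∂_k u)` are weak derivatives. -/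
def IsApplyA {d : ℕ} (Ω : Opens (RSpace d)) (p : ℝ)
    (C : RSpace d → Matrix (Fin d) (Fin d) ℂ) (u f : RSpace d → ℂ) : Prop :=
  MemDomain Ω p u ∧ MemLp f (ENNReal.ofReal p) (lebOn Ω) ∧
  ∃ (g : Fin d → RSpace d → ℂ) (h : Fin d → Fin d → RSpace d → ℂ),
    (∀ k, IsWeakPartial Ω k u (g k)) ∧
    (∀ k l, IsWeakPartial Ω l (fun x => C x k l * g k x) (h k l)) ∧
    ∀ᵐ x ∂(lebOn Ω), f x = - ∑ k, ∑ l, h k l x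

/-- The function `|u|^{p-2} u 𝟙_{[u ≠ 0]}`. -/
def dualFun {d : ℕ} (p : ℝ) (u : RSpace d → ℂ) : RSpace d → ℂ :=
  Set.indicator {x | u x ≠ 0} (fun x => ((‖u x‖ ^ (p - 2) : ℝ) : ℂ) * u x)

/-- The pairing `(f, v) = ∫_Ω f conj(v)`. -/
def pairing {d : ℕ} (Ω : Opens (RSpace d)) (f v : RSpace d → ℂ) : ℂ :=
  ∫ x, f x * (starRingEnd ℂ) (v x) ∂(lebOn Ω)

/-- The sectorial estimate for `A_p` with constant `K`; the pairing is a convergent integral. -/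
def SectorialEstimate {d : ℕ} (Ω : Opens (RSpace d)) (p : ℝ)
    (C : RSpace d → Matrix (Fin d) (Fin d) ℂ) (K : ℝ) : Prop :=
  ∀ u f : RSpace d → ℂ, IsApplyA Ω p C u f →
    Integrable (fun x => f x * (starRingEnd ℂ) (dualFun p u x)) (lebOn Ω) ∧
    |(pairing Ω f (dualFun p u)).im| ≤ K * (pairing Ω f (dualFun p u)).re

end

/-! Integration by parts turns the pairing into the integral of `∑ c_{kl} ∂_k u conj(∂_l (|u|^{p-2}
u))`, so the estimate reduces to one at each point. Where `u = |u| ω` with `|ω| = 1`, write `∂_k u =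
ω (x_k + i y_k)`; the derivative of `|u|^{p-2} u` is then `|u|^{p-2} ω ((p-1) x + i y)`. The phase
`ω` cancels and what remains is a sesquilinear expression in the real vectors `x`, `y`.

Replace `x` by `√(p-1) x` and use the symmetry of `B`. The real part becomes `R(x,x) + R(y,y) - κ
B(x,y)`. The imaginary part becomes `B(x,x) + B(y,y)` plus `κ` times the symmetric part of `R` at
`(x,y)` plus `ν` times an antisymmetric term in `R`. Here `κ = (p-2)/√(p-1)` and `ν = p/√(p-1)`, and
the angle `φ` is made so that `|κ| = 2 cot φ` and `ν = 2 / sin φ`. If `R` is symmetric,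
multiplication by `e^{i(φ-θ)}` moves `R + iB` from `Σ_θ` into `Σ_φ`, and polarization at `x ± y`
gives the constant `cot(φ-θ)` (`sector_bound_symm`). In general the terms are bounded one by one
(`sector_bound_general`).

Two obstacles stand before the integration by parts. For `p < 2` the map `z ↦ |z|^{p-2} z` is
singular at zero; it is replaced by `(|z|² + δ)^{(p-2)/2} z`, whose derivative leads to a convex
combination of the form above and of the original form, which lies in `Σ_θ`
(`gradForm_regDeriv_bound`). Moreover `|∇u|²` is not known to be integrable for `p < 2`; hence `∇u`
in the flux is replaced by `∇u / (1 + ε |∇u|²)`. This multiplies the energy density by a nonnegative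
scalar, so the pointwise estimate survives.

The limits are taken in the order: test functions to `u` in `W^{1,p}`, then `ε → 0`, then `δ → 0`.
The last two are taken only on the divergence side, where an `L_p` function times `|u|^{p-1}`
dominates, so the untruncated energy never has to be integrable (`integral_mul_regFun`,
`sectorial_regFun`, `sectorial_dualFun`). The divergence of the truncated flux is computed by weak
product and chain rules, proved by mollification. -/

set_option linter.unusedSectionVars false

/-! ### Mollification and weak directional derivatives. -/

section Mollification

open Filter Metric ContinuousLinearMap
open scoped Topology ContDiff Convolution

/-- **Pratt's dominated convergence**: the dominating functions may vary, provided that they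
converge almost everywhere and their integrals converge. -/
theorem tendsto_integral_norm_sub_of_dominated_seq {α E : Type*} [MeasurableSpace α]
    {μ : Measure α} [NormedAddCommGroup E] {a : ℕ → α → E} {a' : α → E}
    {b : ℕ → α → ℝ} {b' : α → ℝ}
    (ha : ∀ n, AEStronglyMeasurable (a n) μ) (ha' : Integrable a' μ)
    (hb : ∀ n, Integrable (b n) μ) (hb' : Integrable b' μ)
    (hab : ∀ n, ∀ᵐ x ∂μ, ‖a n x‖ ≤ b n x) (hab' : ∀ᵐ x ∂μ, ‖a' x‖ ≤ b' x)
    (hlim : ∀ᵐ x ∂μ, Tendsto (fun n => a n x) atTop (𝓝 (a' x)))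
    (hblim : ∀ᵐ x ∂μ, Tendsto (fun n => b n x) atTop (𝓝 (b' x)))
    (hbint : Tendsto (fun n => ∫ x, b n x ∂μ) atTop (𝓝 (∫ x, b' x ∂μ))) :
    Tendsto (fun n => ∫ x, ‖a n x - a' x‖ ∂μ) atTop (𝓝 0) := by
  have han : ∀ n, Integrable (a n) μ := fun n => (hb n).mono' (ha n) (hab n)
  have habs : Tendsto (fun n => ∫ x, |b n x - b' x| ∂μ) atTop (𝓝 0) := by
    -- Scheffé's argument: the minimum is dominated by the fixed function `b'`, and `|s - t| = s + t
    -- - 2 min s t`.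
    have h1 : Tendsto (fun n => ∫ x, min (b n x) (b' x) ∂μ) atTop (𝓝 (∫ x, b' x ∂μ)) := by
      refine tendsto_integral_of_dominated_convergence (fun x => b' x)
        (fun n => ((hb n).inf hb').aestronglyMeasurable) hb' (fun n => ?_) ?_
      · filter_upwards [hab n, hab'] with x h1 h2
        have h3 := (norm_nonneg _).trans h1
        have h4 := (norm_nonneg _).trans h2
        rw [Real.norm_of_nonneg (le_min h3 h4)]
        exact min_le_right _ _
      · filter_upwards [hblim] with x hx
        simpa using hx.min (tendsto_const_nhds (x := b' x))
    have h2 : Tendsto (fun n => ∫ x, b n x ∂μ + ∫ x, b' x ∂μ - 2 * ∫ x, min (b n x) (b' x) ∂μ)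
        atTop (𝓝 0) := by
      have := (hbint.add_const (∫ x, b' x ∂μ)).sub (h1.const_mul 2)
      simpa [two_mul] using this
    refine h2.congr fun n => ?_
    have hm : Integrable (fun x => min (b n x) (b' x)) μ := (hb n).inf hb'
    have hs : Integrable (fun x => b n x + b' x) μ := (hb n).add hb'
    rw [← integral_add (hb n) hb', ← integral_const_mul, ← integral_sub hs (hm.const_mul 2)]
    refine integral_congr_ae (Eventually.of_forall fun x => ?_)
    beta_reduce
    rcases le_total (b n x) (b' x) with h | h
    · rw [min_eq_left h, abs_of_nonpos (by linarith)]; ring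
    · rw [min_eq_right h, abs_of_nonneg (by linarith)]; ring
  -- Since `‖a n - a'‖ ≤ b n + b' ≤ 2 b' + |b n - b'|`, the part exceeding `|b n - b'|` has the
  -- fixed majorant `2 b'`.
  have hpos : Tendsto (fun n => ∫ x, max (‖a n x - a' x‖ - |b n x - b' x|) 0 ∂μ) atTop
      (𝓝 (∫ _, (0 : ℝ) ∂μ)) := by
    refine tendsto_integral_of_dominated_convergence (fun x => 2 * b' x)
      (fun n => ?_) (hb'.const_mul 2) (fun n => ?_) ?_
    · exact (((han n).sub ha').norm.sub ((hb n).sub hb').abs).pos_part.aestronglyMeasurable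
    · filter_upwards [hab n, hab'] with x h1 h2
      rw [Real.norm_of_nonneg (le_max_right _ _)]
      refine max_le ?_ (by linarith [norm_nonneg (a' x)])
      have := norm_sub_le (a n x) (a' x)
      have := le_abs_self (b n x - b' x)
      linarith
    · filter_upwards [hlim, hblim] with x h1 h2
      have h3 : Tendsto (fun n => ‖a n x - a' x‖) atTop (𝓝 0) :=
        tendsto_iff_norm_sub_tendsto_zero.1 h1
      have h4 : Tendsto (fun n => |b n x - b' x|) atTop (𝓝 0) :=
        tendsto_iff_norm_sub_tendsto_zero.1 h2
      simpa using (h3.sub h4).max (tendsto_const_nhds (x := (0 : ℝ)))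
  have hsum := hpos.add habs
  simp only [integral_zero, add_zero] at hsum
  refine squeeze_zero (fun n => integral_nonneg fun x => norm_nonneg _) (fun n => ?_) hsum
  have i1 : Integrable (fun x => max (‖a n x - a' x‖ - |b n x - b' x|) 0) μ :=
    (((han n).sub ha').norm.sub ((hb n).sub hb').abs).pos_part
  have i2 : Integrable (fun x => |b n x - b' x|) μ := ((hb n).sub hb').abs
  rw [← integral_add i1 i2]
  refine integral_mono ((han n).sub ha').norm (i1.add i2) fun x => ?_
  have := le_max_left (‖a n x - a' x‖ - |b n x - b' x|) 0
  beta_reduce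
  linarith

variable {V E : Type*} [NormedAddCommGroup V] [NormedSpace ℝ V] [FiniteDimensional ℝ V]
  [MeasurableSpace V] [BorelSpace V] {μ : Measure V} [μ.IsAddHaarMeasure]
  [NormedAddCommGroup E] [NormedSpace ℝ E] [CompleteSpace E]

theorem norm_bump_convolution_le (ρ : ContDiffBump (0 : V)) {g : V → E} (x : V) :
    ‖(ρ.normed μ ⋆[lsmul ℝ ℝ, μ] g) x‖ ≤ (ρ.normed μ ⋆[lsmul ℝ ℝ, μ] fun y => ‖g y‖) x := by
  simp only [convolution_def, lsmul_apply]
  refine (norm_integral_le_integral_norm _).trans (le_of_eq ?_)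
  refine integral_congr_ae (Eventually.of_forall fun y => ?_)
  simp [norm_smul, abs_of_nonneg (ρ.nonneg_normed (μ := μ) y)]

theorem norm_bump_convolution_le_of_bounded (ρ : ContDiffBump (0 : V)) {g : V → E} {M : ℝ}
    (hM : ∀ᵐ x ∂μ, ‖g x‖ ≤ M) (x : V) :
    ‖(ρ.normed μ ⋆[lsmul ℝ ℝ, μ] g) x‖ ≤ M := by
  simp only [convolution_def, lsmul_apply]
  calc ‖∫ t, ρ.normed μ t • g (x - t) ∂μ‖ ≤ ∫ t, ρ.normed μ t * M ∂μ := by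
        refine norm_integral_le_of_norm_le (ρ.integrable_normed.mul_const M) ?_
        have := (quasiMeasurePreserving_sub_left_of_right_invariant μ x).ae hM
        filter_upwards [this] with t ht
        rw [norm_smul, Real.norm_of_nonneg (ρ.nonneg_normed t)]
        exact mul_le_mul_of_nonneg_left ht (ρ.nonneg_normed t)
    _ = M := by rw [integral_mul_const, ρ.integral_normed, one_mul]

/-- Almost everywhere convergence holds at Lebesgue points. The mollifications of `‖g‖` dominate and
all have integral `∫ ‖g‖`, so the varying-majorant form of dominated convergence upgrades it to
`L¹`. -/
theorem tendsto_integral_norm_bump_convolution_sub {ρ : ℕ → ContDiffBump (0 : V)} {K : ℝ}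
    (hρ : Tendsto (fun n => (ρ n).rOut) atTop (𝓝 0)) (hρK : ∀ n, (ρ n).rOut ≤ K * (ρ n).rIn)
    {g : V → E} (hg : Integrable g μ) :
    Tendsto (fun n => ∫ x, ‖((ρ n).normed μ ⋆[lsmul ℝ ℝ, μ] g) x - g x‖ ∂μ) atTop (𝓝 0) := by
  have hint : ∀ n, Integrable ((ρ n).normed μ ⋆[lsmul ℝ ℝ, μ] fun y => ‖g y‖) μ := fun n =>
    (ρ n).integrable_normed.integrable_convolution _ hg.norm
  refine tendsto_integral_norm_sub_of_dominated_seq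
    (b := fun n => (ρ n).normed μ ⋆[lsmul ℝ ℝ, μ] fun y => ‖g y‖) (b' := fun x => ‖g x‖)
    (fun n => ((ρ n).integrable_normed.integrable_convolution _ hg).aestronglyMeasurable) hg
    hint hg.norm
    (fun n => Eventually.of_forall fun x => norm_bump_convolution_le (ρ n) x)
    (Eventually.of_forall fun x => le_rfl)
    (ContDiffBump.ae_convolution_tendsto_right_of_locallyIntegrable hρ
      (Eventually.of_forall hρK) hg.locallyIntegrable)
    (ContDiffBump.ae_convolution_tendsto_right_of_locallyIntegrable hρ
      (Eventually.of_forall hρK) hg.norm.locallyIntegrable) ?_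
  refine tendsto_const_nhds.congr fun n => ?_
  rw [integral_convolution (lsmul ℝ ℝ) (ρ n).integrable_normed hg.norm]
  simp [ContDiffBump.integral_normed]

/-- `g` is the weak derivative of `f` on `U` in the direction `v`. -/
structure HasWeakDerivOn (μ : Measure V) (U : Set V) (v : V) (f g : V → E) : Prop where
  locInt : LocallyIntegrableOn f U μ
  locInt_deriv : LocallyIntegrableOn g U μ
  integral_eq : ∀ φ : V → ℝ, ContDiff ℝ ∞ φ → HasCompactSupport φ → tsupport φ ⊆ U →
    ∫ x, fderiv ℝ φ x v • f x ∂μ = -∫ x, φ x • g x ∂μ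

theorem integrable_smul_of_locallyIntegrableOn {U : Set V} {f : V → E} {φ : V → ℝ}
    (hf : LocallyIntegrableOn f U μ)
    (hφ : Continuous φ) (hc : HasCompactSupport φ) (hs : tsupport φ ⊆ U) :
    Integrable (fun x => φ x • f x) μ := by
  have h1 : IntegrableOn f (tsupport φ) μ := hf.integrableOn_compact_subset hs hc
  have h2 : IntegrableOn (fun x => φ x • f x) (tsupport φ) μ :=
    h1.continuousOn_smul hφ.continuousOn hc
  refine (integrableOn_iff_integrable_of_support_subset ?_).1 h2
  intro x hx
  refine subset_tsupport _ ?_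
  contrapose! hx
  simp [Function.notMem_support.1 hx]

theorem HasWeakDerivOn.ae_eq {U : Set V} (hU : IsOpen U) {v : V} {f g g' : V → E}
    (h : HasWeakDerivOn μ U v f g) (h' : HasWeakDerivOn μ U v f g') :
    ∀ᵐ x ∂μ.restrict U, g x = g' x := by
  have key := hU.ae_eq_zero_of_integral_contDiff_smul_eq_zero (μ := μ)
    (h.locInt_deriv.sub h'.locInt_deriv) fun φ hφ hc hs => by
      simp only [Pi.sub_apply, smul_sub]
      rw [integral_sub (integrable_smul_of_locallyIntegrableOn h.locInt_deriv hφ.continuous hc hs)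
        (integrable_smul_of_locallyIntegrableOn h'.locInt_deriv hφ.continuous hc hs)]
      have h1 := h.integral_eq φ hφ hc hs
      have h2 := h'.integral_eq φ hφ hc hs
      rw [h1] at h2
      rw [neg_injective h2, sub_self]
  rw [ae_restrict_iff' hU.measurableSet]
  filter_upwards [key] with x hx hxU using sub_eq_zero.1 (hx hxU)

/-- Functions with a weak derivative are approximated by their mollifications on compact sets. -/
theorem HasWeakDerivOn.exists_smooth_approx {U : Set V} (hU : IsOpen U) {v : V} {f g : V → E}
    (h : HasWeakDerivOn μ U v f g) {K : Set V} (hK : IsCompact K) (hKU : K ⊆ U) :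
    ∃ F : ℕ → V → E, (∀ n, ContDiff ℝ ∞ (F n)) ∧
      (∀ᵐ x ∂μ.restrict K, Tendsto (fun n => F n x) atTop (𝓝 (f x))) ∧
      (∀ᵐ x ∂μ.restrict K, Tendsto (fun n => fderiv ℝ (F n) x v) atTop (𝓝 (g x))) ∧
      Tendsto (fun n => ∫ x in K, ‖F n x - f x‖ ∂μ) atTop (𝓝 0) ∧
      Tendsto (fun n => ∫ x in K, ‖fderiv ℝ (F n) x v - g x‖ ∂μ) atTop (𝓝 0) ∧
      (∀ M, 0 ≤ M → (∀ᵐ x ∂μ.restrict U, ‖f x‖ ≤ M) → ∀ n x, ‖F n x‖ ≤ M) ∧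
      (∀ M, 0 ≤ M → (∀ᵐ x ∂μ.restrict U, ‖g x‖ ≤ M) →
        ∀ n, ∀ x ∈ K, ‖fderiv ℝ (F n) x v‖ ≤ M) := by
  obtain ⟨r, hr, hrU⟩ := hK.exists_cthickening_subset_open hU hKU
  set K' := cthickening r K with hK'
  have hK'c : IsCompact K' := hK.cthickening
  have hK'm : MeasurableSet K' := hK'c.measurableSet
  have hKm : MeasurableSet K := hK.measurableSet
  have hKK' : K ⊆ K' := self_subset_cthickening K
  -- The `+ 2` keeps the outer radius strictly below `r` already at `n = 0`; the fixed ratio of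
  -- radii is what convergence at Lebesgue points asks for.
  let ρ : ℕ → ContDiffBump (0 : V) := fun n =>
    ⟨r / (n + 2) / 2, r / (n + 2), by positivity, half_lt_self (by positivity)⟩
  have hρr : ∀ n, (ρ n).rOut < r := fun n =>
    div_lt_self hr (by have : (0 : ℝ) ≤ n := n.cast_nonneg; linarith)
  have hρ0 : Tendsto (fun n => (ρ n).rOut) atTop (𝓝 0) := by
    refine tendsto_const_nhds.div_atTop ?_
    exact tendsto_atTop_add_const_right _ _ tendsto_natCast_atTop_atTop
  have hρ2 : ∀ n, (ρ n).rOut ≤ 2 * (ρ n).rIn := fun n => by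
    change r / (n + 2) ≤ 2 * (r / (n + 2) / 2)
    linarith
  -- Cutting off to `K'` makes the functions globally integrable, and is invisible on `K` because
  -- every bump has radius below `r`.
  set f₁ := K'.indicator f with hf₁
  set g₁ := K'.indicator g with hg₁
  have if₁ : Integrable f₁ μ :=
    (integrable_indicator_iff hK'm).2 (h.locInt.integrableOn_compact_subset hrU hK'c)
  have ig₁ : Integrable g₁ μ :=
    (integrable_indicator_iff hK'm).2 (h.locInt_deriv.integrableOn_compact_subset hrU hK'c)
  have hρs : ∀ n, ContDiff ℝ ∞ ((ρ n).normed μ) := fun n => (ρ n).contDiff_normed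
  have hρc : ∀ n, HasCompactSupport ((ρ n).normed μ) := fun n => (ρ n).hasCompactSupport_normed
  have hder : ∀ n, ∀ x ∈ K, fderiv ℝ ((ρ n).normed μ ⋆[lsmul ℝ ℝ, μ] f₁) x v
      = ((ρ n).normed μ ⋆[lsmul ℝ ℝ, μ] g₁) x := by
    intro n x hx
    have e1 : (fderiv ℝ ((ρ n).normed μ ⋆[lsmul ℝ ℝ, μ] f₁) x) v
        = ∫ t, fderiv ℝ ((ρ n).normed μ) (x - t) v • f₁ t ∂μ := by
      have hd := (hρc n).hasFDerivAt_convolution_left (lsmul ℝ ℝ)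
        ((hρs n).of_le (by exact_mod_cast le_top)) if₁.locallyIntegrable x
      rw [hd.fderiv, convolution_eq_swap, ContinuousLinearMap.integral_apply]
      · rfl
      · have := ((hρc n).fderiv ℝ).convolutionExists_left ((lsmul ℝ ℝ : ℝ →L[ℝ] E →L[ℝ] E).precompL V)
          ((hρs n).continuous_fderiv (by simp)) if₁.locallyIntegrable x
        exact this.integrable_swap
    have hsub : tsupport (fun t => (ρ n).normed μ (x - t)) ⊆ closedBall x (ρ n).rOut := by
      refine closure_minimal (fun t ht => ?_) isClosed_closedBall
      have : x - t ∈ Function.support ((ρ n).normed μ) := ht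
      rw [(ρ n).support_normed_eq] at this
      simp only [mem_ball, dist_zero_right] at this
      rw [mem_closedBall, dist_comm, dist_eq_norm]
      exact this.le
    have hball : closedBall x (ρ n).rOut ⊆ K' :=
      (closedBall_subset_closedBall (hρr n).le).trans (closedBall_subset_cthickening hx r)
    have hψs : ContDiff ℝ ∞ (fun t => (ρ n).normed μ (x - t)) :=
      (hρs n).comp (contDiff_const.sub contDiff_id)
    have hψd : ∀ t, fderiv ℝ (fun t => (ρ n).normed μ (x - t)) t v
        = - fderiv ℝ ((ρ n).normed μ) (x - t) v := by
      intro t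
      have h1 : HasFDerivAt ((ρ n).normed μ) (fderiv ℝ ((ρ n).normed μ) (x - t)) (x - t) :=
        ((hρs n).differentiable (by simp) _).hasFDerivAt
      have h2 : HasFDerivAt (fun t : V => x - t) (-ContinuousLinearMap.id ℝ V) t :=
        (hasFDerivAt_id t).const_sub x
      have h3 : HasFDerivAt (fun t => (ρ n).normed μ (x - t)) _ t := h1.comp t h2
      rw [h3.fderiv]
      simp
    -- For `x ∈ K` the reflected bump `t ↦ ρ (x - t)` is an admissible test function; the sign from
    -- the reflection cancels the one in the definition of the weak derivative.
    have key := h.integral_eq _ hψs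
      (HasCompactSupport.of_support_subset_isCompact (isCompact_closedBall x (ρ n).rOut)
        ((subset_tsupport _).trans hsub)) (hsub.trans (hball.trans hrU))
    rw [e1, convolution_eq_swap]
    simp only [lsmul_apply]
    have hz : ∀ t, t ∉ K' → (ρ n).normed μ (x - t) = 0 := fun t ht => by
      by_contra h0
      exact ht (hball (hsub (subset_tsupport _ h0)))
    have hz' : ∀ t, t ∉ K' → fderiv ℝ ((ρ n).normed μ) (x - t) v = 0 := fun t ht => by
      rw [← neg_eq_zero, ← hψd]
      have : t ∉ tsupport (fun t => (ρ n).normed μ (x - t)) := fun h0 => ht (hball (hsub h0))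
      have := fun h1 => this (tsupport_fderiv_subset ℝ (subset_tsupport _ h1))
      rw [Function.notMem_support.1 this]
      rfl
    have e2 : ∫ t, fderiv ℝ ((ρ n).normed μ) (x - t) v • f₁ t ∂μ
        = - ∫ t, fderiv ℝ (fun t => (ρ n).normed μ (x - t)) t v • f t ∂μ := by
      rw [← integral_neg]
      refine integral_congr_ae (Eventually.of_forall fun t => ?_)
      simp only [hψd, neg_smul, neg_neg]
      by_cases ht : t ∈ K'
      · rw [hf₁, Set.indicator_of_mem ht]
      · rw [hz' t ht, zero_smul, zero_smul]
    have e3 : ∫ t, (ρ n).normed μ (x - t) • g₁ t ∂μ = ∫ t, (ρ n).normed μ (x - t) • g t ∂μ := by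
      refine integral_congr_ae (Eventually.of_forall fun t => ?_)
      by_cases ht : t ∈ K'
      · simp only [hg₁, Set.indicator_of_mem ht]
      · simp only [hz t ht, zero_smul]
    rw [e2, e3, key, neg_neg]
  have hbd : ∀ (w : V → E) (M : ℝ), 0 ≤ M → (∀ᵐ x ∂μ.restrict U, ‖w x‖ ≤ M) →
      ∀ᵐ x ∂μ, ‖K'.indicator w x‖ ≤ M := by
    intro w M hM hw
    rw [ae_restrict_iff' hU.measurableSet] at hw
    filter_upwards [hw] with x hx
    by_cases hxK : x ∈ K'
    · rw [Set.indicator_of_mem hxK]; exact hx (hrU hxK)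
    · rw [Set.indicator_of_notMem hxK]; simpa using hM
  have hL1 : ∀ (w : V → E), Integrable (K'.indicator w) μ → Tendsto (fun n => ∫ x in K,
      ‖((ρ n).normed μ ⋆[lsmul ℝ ℝ, μ] K'.indicator w) x - w x‖ ∂μ) atTop (𝓝 0) := by
    intro w hw
    refine squeeze_zero (fun n => integral_nonneg fun x => norm_nonneg _) (fun n => ?_)
      (tendsto_integral_norm_bump_convolution_sub hρ0 hρ2 hw)
    have hi : Integrable (fun x => ‖((ρ n).normed μ ⋆[lsmul ℝ ℝ, μ] K'.indicator w) x
        - K'.indicator w x‖) μ :=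
      (((ρ n).integrable_normed.integrable_convolution _ hw).sub hw).norm
    calc _ = ∫ x in K, ‖((ρ n).normed μ ⋆[lsmul ℝ ℝ, μ] K'.indicator w) x
              - K'.indicator w x‖ ∂μ := by
          refine setIntegral_congr_fun hKm fun x hx => ?_
          simp only [Set.indicator_of_mem (hKK' hx)]
      _ ≤ _ := setIntegral_le_integral hi (Eventually.of_forall fun x => norm_nonneg _)
  have hae : ∀ (w : V → E), Integrable (K'.indicator w) μ → ∀ᵐ x ∂μ.restrict K,
      Tendsto (fun n => ((ρ n).normed μ ⋆[lsmul ℝ ℝ, μ] K'.indicator w) x) atTop (𝓝 (w x)) := by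
    intro w hw
    rw [ae_restrict_iff' hKm]
    filter_upwards [ContDiffBump.ae_convolution_tendsto_right_of_locallyIntegrable hρ0
      (Eventually.of_forall hρ2) hw.locallyIntegrable] with x hx hxK
    rwa [Set.indicator_of_mem (hKK' hxK)] at hx
  refine ⟨fun n => (ρ n).normed μ ⋆[lsmul ℝ ℝ, μ] f₁, fun n => ?_, hae f if₁, ?_, hL1 f if₁, ?_,
    fun M hM hf n x => norm_bump_convolution_le_of_bounded _ (hbd f M hM hf) x,
    fun M hM hg n x hx => ?_⟩
  · exact (hρc n).contDiff_convolution_left _ (hρs n) if₁.locallyIntegrable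
  · rw [ae_restrict_iff' hKm]
    have := hae g ig₁
    rw [ae_restrict_iff' hKm] at this
    filter_upwards [this] with x hx hxK
    refine (hx hxK).congr fun n => (hder n x hxK).symm
  · refine (hL1 g ig₁).congr fun n => setIntegral_congr_fun hKm fun x hx => ?_
    simp only [hder n x hx, hg₁]
  · simp only [hder n x hx]
    exact norm_bump_convolution_le_of_bounded _ (hbd g M hM hg) x

end Mollification

/-! ### Chain and product rules for weak derivatives. -/

section WeakCalculus

open Filter Metric ContinuousLinearMap
open scoped Topology ContDiff

/-- A bounded, almost everywhere convergent factor may be paired with an `L¹`-convergent one: split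
`A n (b n)` into `A n b'`, handled by dominated convergence, and `A n (b n - b')`, of integral at
most `L ‖b n - b'‖₁`. Both calculus rules below pass to the limit in this way. -/
theorem tendsto_integral_clm_apply {α E F : Type*} [MeasurableSpace α] {ν : Measure α}
    [NormedAddCommGroup E] [NormedSpace ℝ E] [NormedAddCommGroup F] [NormedSpace ℝ F]
    {A : ℕ → α → E →L[ℝ] F} {A' : α → E →L[ℝ] F} {b : ℕ → α → E} {b' : α → E} {L : ℝ}
    (hA : ∀ n, AEStronglyMeasurable (A n) ν) (hb : ∀ n, Integrable (b n) ν)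
    (hb' : Integrable b' ν) (hL : ∀ n, ∀ᵐ x ∂ν, ‖A n x‖ ≤ L)
    (hAlim : ∀ᵐ x ∂ν, Tendsto (fun n => A n x) atTop (𝓝 (A' x)))
    (hblim : Tendsto (fun n => ∫ x, ‖b n x - b' x‖ ∂ν) atTop (𝓝 0)) :
    Tendsto (fun n => ∫ x, A n x (b n x) ∂ν) atTop (𝓝 (∫ x, A' x (b' x) ∂ν)) := by
  have happ : Continuous fun p : (E →L[ℝ] F) × E => p.1 p.2 := by fun_prop
  have hm : ∀ n (w : α → E), AEStronglyMeasurable w ν →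
      AEStronglyMeasurable (fun x => A n x (w x)) ν := fun n w hw =>
    happ.comp_aestronglyMeasurable ((hA n).prodMk hw)
  have hi : ∀ n (w : α → E), Integrable w ν → Integrable (fun x => A n x (w x)) ν := by
    intro n w hw
    refine (hw.norm.const_mul L).mono' (hm n w hw.aestronglyMeasurable) ?_
    filter_upwards [hL n] with x hx using (A n x).le_of_opNorm_le hx _
  have h1 : Tendsto (fun n => ∫ x, A n x (b' x) ∂ν) atTop (𝓝 (∫ x, A' x (b' x) ∂ν)) := by
    refine tendsto_integral_of_dominated_convergence (fun x => L * ‖b' x‖)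
      (fun n => hm n _ hb'.aestronglyMeasurable) (hb'.norm.const_mul L) (fun n => ?_) ?_
    · filter_upwards [hL n] with x hx using (A n x).le_of_opNorm_le hx _
    · filter_upwards [hAlim] with x hx
      exact (happ.tendsto (A' x, b' x)).comp (hx.prodMk_nhds tendsto_const_nhds)
  have h2 : Tendsto (fun n => ∫ x, A n x (b n x - b' x) ∂ν) atTop (𝓝 0) := by
    have h3 := hblim.const_mul L
    rw [mul_zero] at h3
    refine squeeze_zero_norm (fun n => ?_) h3
    rw [← integral_const_mul]
    refine norm_integral_le_of_norm_le (((hb n).sub hb').norm.const_mul L) ?_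
    filter_upwards [hL n] with x hx using (A n x).le_of_opNorm_le hx _
  have h3 := h1.add h2
  rw [add_zero] at h3
  refine h3.congr fun n => ?_
  have h4 : Integrable (fun x => A n x (b n x - b' x)) ν := hi n _ ((hb n).sub hb')
  rw [← integral_add (hi n _ hb') h4]
  refine integral_congr_ae (Eventually.of_forall fun x => ?_)
  simp

variable {V E F : Type*} [NormedAddCommGroup V] [NormedSpace ℝ V] [FiniteDimensional ℝ V]
  [MeasurableSpace V] [BorelSpace V] {μ : Measure V} [μ.IsAddHaarMeasure]
  [NormedAddCommGroup E] [NormedSpace ℝ E] [CompleteSpace E]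
  [NormedAddCommGroup F] [NormedSpace ℝ F] [CompleteSpace F]

theorem integral_fderiv_smul_eq_neg {φ : V → ℝ} (hφ : ContDiff ℝ ∞ φ) (hc : HasCompactSupport φ)
    {w : V → E} (hw : ContDiff ℝ 1 w) (v : V) :
    ∫ x, fderiv ℝ φ x v • w x ∂μ = -∫ x, φ x • fderiv ℝ w x v ∂μ := by
  have hφ' : Continuous fun x => fderiv ℝ φ x v :=
    (hφ.continuous_fderiv (by simp)).clm_apply continuous_const
  have hw' : Continuous fun x => fderiv ℝ w x v :=
    (hw.continuous_fderiv (by simp)).clm_apply continuous_const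
  rw [integral_smul_fderiv_eq_neg_fderiv_smul_of_integrable, neg_neg]
  · exact (hφ'.smul hw.continuous).integrable_of_hasCompactSupport
      ((hc.fderiv_apply ℝ v).smul_right)
  · exact (hφ.continuous.smul hw').integrable_of_hasCompactSupport hc.smul_right
  · exact (hφ.continuous.smul hw.continuous).integrable_of_hasCompactSupport hc.smul_right
  · exact fun x _ => hφ.differentiable (by simp) x
  · exact fun x _ => hw.differentiable (by simp) x

theorem integral_eq_setIntegral_of_tsupport {φ : V → ℝ} {K : Set V} (hK : tsupport φ ⊆ K)
    (w : V → E) : ∫ x, φ x • w x ∂μ = ∫ x in K, φ x • w x ∂μ := by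
  refine (setIntegral_eq_integral_of_forall_compl_eq_zero fun x hx => ?_).symm
  rw [image_eq_zero_of_notMem_tsupport fun h => hx (hK h), zero_smul]

/-- Chain rule for weak derivatives. -/
theorem HasWeakDerivOn.comp_contDiff {U : Set V} (hU : IsOpen U) {v : V} {f g : V → E}
    (h : HasWeakDerivOn μ U v f g) {Ψ : E → F} (hΨ : ContDiff ℝ 1 Ψ) {L : ℝ}
    (hL : ∀ z, ‖fderiv ℝ Ψ z‖ ≤ L) :
    HasWeakDerivOn μ U v (fun x => Ψ (f x)) (fun x => fderiv ℝ Ψ (f x) (g x)) := by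
  have happ : Continuous fun p : (E →L[ℝ] F) × E => p.1 p.2 := by fun_prop
  have hΨ' : Continuous (fderiv ℝ Ψ) := hΨ.continuous_fderiv (by simp)
  have hlip : ∀ y z, ‖Ψ y - Ψ z‖ ≤ L * ‖y - z‖ := fun y z =>
    convex_univ.norm_image_sub_le_of_norm_fderiv_le
      (fun x _ => hΨ.differentiable (by simp) x) (fun x _ => hL x) (Set.mem_univ z)
      (Set.mem_univ y)
  have hint : ∀ K ⊆ U, IsCompact K → IntegrableOn (fun x => Ψ (f x)) K μ := by
    intro K hKU hK
    have hf := h.locInt.integrableOn_compact_subset hKU hK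
    have : IsFiniteMeasure (μ.restrict K) := ⟨by simpa using hK.measure_lt_top⟩
    refine ((integrable_const ‖Ψ 0‖).add (hf.norm.const_mul L)).mono'
      (hΨ.continuous.comp_aestronglyMeasurable hf.aestronglyMeasurable)
      (Eventually.of_forall fun x => ?_)
    have h1 := hlip (f x) 0
    rw [sub_zero] at h1
    have h2 := norm_sub_norm_le (Ψ (f x)) (Ψ 0)
    simp only [Pi.add_apply]
    linarith
  have hint' : ∀ K ⊆ U, IsCompact K → IntegrableOn (fun x => fderiv ℝ Ψ (f x) (g x)) K μ := by
    intro K hKU hK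
    have hf := h.locInt.integrableOn_compact_subset hKU hK
    have hg := h.locInt_deriv.integrableOn_compact_subset hKU hK
    exact (hg.norm.const_mul L).mono' (happ.comp_aestronglyMeasurable
      ((hΨ'.comp_aestronglyMeasurable hf.aestronglyMeasurable).prodMk hg.aestronglyMeasurable))
      (Eventually.of_forall fun x => (fderiv ℝ Ψ (f x)).le_of_opNorm_le (hL _) _)
  refine ⟨(locallyIntegrableOn_iff hU.isLocallyClosed).2 hint,
    (locallyIntegrableOn_iff hU.isLocallyClosed).2 hint', fun φ hφ hc hs => ?_⟩
  -- Mollify on the support of the test function, apply the classical chain rule, and pass to the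
  -- limit on both sides.
  obtain ⟨G, hGs, hGf, -, hGf1, hGg1, -, -⟩ := h.exists_smooth_approx hU hc hs
  set K := tsupport φ with hK
  have hf := h.locInt.integrableOn_compact_subset hs hc
  have hg := h.locInt_deriv.integrableOn_compact_subset hs hc
  have hφ' : Continuous fun x => fderiv ℝ φ x v :=
    (hφ.continuous_fderiv (by simp)).clm_apply continuous_const
  have hcont : ∀ {w : V → E}, Continuous w → IntegrableOn w K μ := fun hw =>
    hw.continuousOn.integrableOn_compact hc
  obtain ⟨C₀, hC₀⟩ := hφ.continuous.bounded_above_of_compact_support hc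
  obtain ⟨C₁, hC₁⟩ := hφ'.bounded_above_of_compact_support (hc.fderiv_apply ℝ v)
  have hC₀0 : 0 ≤ C₀ := (norm_nonneg _).trans (hC₀ 0)
  have hC₁0 : 0 ≤ C₁ := (norm_nonneg _).trans (hC₁ 0)
  have hGd : ∀ n, Continuous fun x => fderiv ℝ (G n) x v := fun n =>
    ((hGs n).continuous_fderiv (by simp)).clm_apply continuous_const
  have hΨG : ∀ n, ContDiff ℝ 1 fun x => Ψ (G n x) := fun n =>
    hΨ.comp ((hGs n).of_le (by exact_mod_cast le_top))
  have hsmooth : ∀ n, ∫ x in K, fderiv ℝ φ x v • Ψ (G n x) ∂μ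
      = -∫ x in K, φ x • fderiv ℝ Ψ (G n x) (fderiv ℝ (G n) x v) ∂μ := by
    intro n
    rw [← integral_eq_setIntegral_of_tsupport (tsupport_fderiv_apply_subset ℝ v),
      ← integral_eq_setIntegral_of_tsupport subset_rfl,
      integral_fderiv_smul_eq_neg hφ hc (hΨG n)]
    congr 2
    ext x
    have h1 := (hΨ.differentiable (by simp) (G n x)).hasFDerivAt.comp x
      ((hGs n).differentiable (by simp) x).hasFDerivAt
    have h2 : HasFDerivAt (fun x => Ψ (G n x)) _ x := h1
    rw [h2.fderiv]
    rfl
  have lim1 : Tendsto (fun n => ∫ x in K, fderiv ℝ φ x v • Ψ (G n x) ∂μ) atTop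
      (𝓝 (∫ x in K, fderiv ℝ φ x v • Ψ (f x) ∂μ)) := by
    have hi2 : Integrable (fun x => Ψ (f x)) (μ.restrict K) := hint K hs hc
    refine tendsto_integral_clm_apply
      (A := fun _ x => fderiv ℝ φ x v • ContinuousLinearMap.id ℝ F)
      (A' := fun x => fderiv ℝ φ x v • ContinuousLinearMap.id ℝ F) (L := C₁)
      (b := fun n x => Ψ (G n x)) (b' := fun x => Ψ (f x)) (fun n => ?_)
      (fun n => (hΨG n).continuous.continuousOn.integrableOn_compact hc) hi2
      (fun n => Eventually.of_forall fun x => ?_)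
      (Eventually.of_forall fun x => tendsto_const_nhds) ?_
    · exact (hφ'.smul continuous_const).aestronglyMeasurable
    · rw [norm_smul]
      exact (mul_le_of_le_one_right (norm_nonneg _) norm_id_le).trans (hC₁ x)
    · have h3 := hGf1.const_mul L
      rw [mul_zero] at h3
      refine squeeze_zero (fun n => integral_nonneg fun x => norm_nonneg _) (fun n => ?_) h3
      rw [← integral_const_mul]
      exact integral_mono
        (((hΨG n).continuous.continuousOn.integrableOn_compact hc).sub hi2).norm
        (((hcont (hGs n).continuous).sub hf).norm.const_mul L) fun x => hlip _ _
  have lim2 : Tendsto (fun n => ∫ x in K, φ x • fderiv ℝ Ψ (G n x) (fderiv ℝ (G n) x v) ∂μ) atTop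
      (𝓝 (∫ x in K, φ x • fderiv ℝ Ψ (f x) (g x) ∂μ)) := by
    refine tendsto_integral_clm_apply (A := fun n x => φ x • fderiv ℝ Ψ (G n x))
      (A' := fun x => φ x • fderiv ℝ Ψ (f x)) (L := C₀ * L)
      (b := fun n x => fderiv ℝ (G n) x v) (b' := g) (fun n => ?_)
      (fun n => hcont (hGd n)) hg (fun n => Eventually.of_forall fun x => ?_) ?_ hGg1
    · exact (hφ.continuous.smul (hΨ'.comp (hGs n).continuous)).aestronglyMeasurable
    · rw [norm_smul]
      exact mul_le_mul (hC₀ x) (hL _) (norm_nonneg _) hC₀0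
    · filter_upwards [hGf] with x hx
      exact tendsto_const_nhds.smul ((hΨ'.tendsto _).comp hx)
  rw [integral_eq_setIntegral_of_tsupport (K := K) (tsupport_fderiv_apply_subset ℝ v),
    integral_eq_setIntegral_of_tsupport (φ := φ) (K := K) subset_rfl]
  exact tendsto_nhds_unique lim1 (lim2.neg.congr fun n => (hsmooth n).symm)

/-- Product rule for weak derivatives, one factor being bounded with bounded weak derivative. -/
theorem HasWeakDerivOn.mul_of_bounded {U : Set V} (hU : IsOpen U) {v : V} {a a' b b' : V → ℂ}
    (ha : HasWeakDerivOn μ U v a a') (hb : HasWeakDerivOn μ U v b b') {M : ℝ}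
    (hM : ∀ᵐ x ∂μ.restrict U, ‖a x‖ ≤ M) (hM' : ∀ᵐ x ∂μ.restrict U, ‖a' x‖ ≤ M) (hM0 : 0 ≤ M) :
    HasWeakDerivOn μ U v (fun x => a x * b x) (fun x => a' x * b x + a x * b' x) := by
  have hmul : ∀ {a b : V → ℂ}, LocallyIntegrableOn a U μ → LocallyIntegrableOn b U μ →
      (∀ᵐ x ∂μ.restrict U, ‖a x‖ ≤ M) → ∀ K ⊆ U, IsCompact K →
      IntegrableOn (fun x => a x * b x) K μ := by
    intro a b ha hb hM K hKU hK
    have h1 := ha.integrableOn_compact_subset hKU hK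
    have h2 := hb.integrableOn_compact_subset hKU hK
    exact h2.bdd_mul h1.aestronglyMeasurable (ae_restrict_of_ae_restrict_of_subset hKU hM)
  refine ⟨(locallyIntegrableOn_iff hU.isLocallyClosed).2 (hmul ha.locInt hb.locInt hM),
    (locallyIntegrableOn_iff hU.isLocallyClosed).2 fun K hKU hK =>
      (hmul ha.locInt_deriv hb.locInt hM' K hKU hK).add
        (hmul ha.locInt hb.locInt_deriv hM K hKU hK), fun φ hφ hc hs => ?_⟩
  obtain ⟨A, hAs, hAf, hAg, -, -, hAM, hAM'⟩ := ha.exists_smooth_approx hU hc hs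
  obtain ⟨B, hBs, -, -, hBf1, hBg1, -, -⟩ := hb.exists_smooth_approx hU hc hs
  replace hAM := hAM M hM0 hM
  replace hAM' := hAM' M hM0 hM'
  set K := tsupport φ with hK
  have hKm : MeasurableSet K := (isClosed_tsupport φ).measurableSet
  have hbi := hb.locInt.integrableOn_compact_subset hs hc
  have hbi' := hb.locInt_deriv.integrableOn_compact_subset hs hc
  have hφ' : Continuous fun x => fderiv ℝ φ x v :=
    (hφ.continuous_fderiv (by simp)).clm_apply continuous_const
  have hcont : ∀ {w : V → ℂ}, Continuous w → IntegrableOn w K μ := fun hw =>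
    hw.continuousOn.integrableOn_compact hc
  obtain ⟨C₀, hC₀⟩ := hφ.continuous.bounded_above_of_compact_support hc
  obtain ⟨C₁, hC₁⟩ := hφ'.bounded_above_of_compact_support (hc.fderiv_apply ℝ v)
  have hC₀0 : 0 ≤ C₀ := (norm_nonneg _).trans (hC₀ 0)
  have hC₁0 : 0 ≤ C₁ := (norm_nonneg _).trans (hC₁ 0)
  have hAd : ∀ n, Continuous fun x => fderiv ℝ (A n) x v := fun n =>
    ((hAs n).continuous_fderiv (by simp)).clm_apply continuous_const
  have hBd : ∀ n, Continuous fun x => fderiv ℝ (B n) x v := fun n =>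
    ((hBs n).continuous_fderiv (by simp)).clm_apply continuous_const
  have hAB : ∀ n, ContDiff ℝ 1 fun x => A n x * B n x := fun n =>
    ((hAs n).mul (hBs n)).of_le (by exact_mod_cast le_top)
  -- In each of the three integrals of the product rule one factor comes from `a`, hence is bounded
  -- by `M` and converges almost everywhere, and the other comes from `b` and converges in `L¹`.
  have general : ∀ (ψ : V → ℝ) (C : ℝ) (P : ℕ → V → ℂ) (P' : V → ℂ) (Q : ℕ → V → ℂ) (Q' : V → ℂ),
      Continuous ψ → (∀ x, ‖ψ x‖ ≤ C) → (∀ n, Continuous (P n)) → (∀ n, Continuous (Q n)) →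
      IntegrableOn Q' K μ → (∀ n, ∀ x ∈ K, ‖P n x‖ ≤ M) →
      (∀ᵐ x ∂μ.restrict K, Tendsto (fun n => P n x) atTop (𝓝 (P' x))) →
      Tendsto (fun n => ∫ x in K, ‖Q n x - Q' x‖ ∂μ) atTop (𝓝 0) →
      Tendsto (fun n => ∫ x in K, ψ x • (P n x * Q n x) ∂μ) atTop
        (𝓝 (∫ x in K, ψ x • (P' x * Q' x) ∂μ)) := by
    intro ψ C P P' Q Q' hψ hC hP hQ hQ' hPM hPl hQl
    refine tendsto_integral_clm_apply (A := fun n x => ψ x • ContinuousLinearMap.mul ℝ ℂ (P n x))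
      (A' := fun x => ψ x • ContinuousLinearMap.mul ℝ ℂ (P' x)) (L := C * M) (fun n => ?_)
      (fun n => hcont (hQ n)) hQ' (fun n => ?_) ?_ hQl
    · exact (hψ.smul ((ContinuousLinearMap.mul ℝ ℂ).continuous.comp (hP n))).aestronglyMeasurable
    · filter_upwards [ae_restrict_mem hKm] with x hx
      rw [norm_smul, ContinuousLinearMap.opNorm_mul_apply]
      exact mul_le_mul (hC x) (hPM n x hx) (norm_nonneg _) ((norm_nonneg _).trans (hC x))
    · filter_upwards [hPl] with x hx
      exact tendsto_const_nhds.smul (((ContinuousLinearMap.mul ℝ ℂ).continuous.tendsto _).comp hx)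
  have lim1 := general _ C₁ A a B b hφ' hC₁ (fun n => (hAs n).continuous)
    (fun n => (hBs n).continuous) hbi (fun n x _ => hAM n x) hAf hBf1
  have lim2 := general φ C₀ (fun n x => fderiv ℝ (A n) x v) a' B b hφ.continuous hC₀ hAd
    (fun n => (hBs n).continuous) hbi hAM' hAg hBf1
  have lim3 := general φ C₀ A a (fun n x => fderiv ℝ (B n) x v) b' hφ.continuous hC₀
    (fun n => (hAs n).continuous) hBd hbi' (fun n x _ => hAM n x) hAf hBg1
  have hφK : ∀ {w : V → ℂ}, IntegrableOn w K μ → IntegrableOn (fun x => φ x • w x) K μ :=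
    fun hw => hw.continuousOn_smul hφ.continuous.continuousOn hc
  have hsmooth : ∀ n, ∫ x in K, fderiv ℝ φ x v • (A n x * B n x) ∂μ
      = -(∫ x in K, φ x • (fderiv ℝ (A n) x v * B n x) ∂μ
        + ∫ x in K, φ x • (A n x * fderiv ℝ (B n) x v) ∂μ) := by
    intro n
    have i1 : IntegrableOn (fun x => φ x • (fderiv ℝ (A n) x v * B n x)) K μ :=
      hφK (hcont ((hAd n).mul (hBs n).continuous))
    have i2 : IntegrableOn (fun x => φ x • (A n x * fderiv ℝ (B n) x v)) K μ :=
      hφK (hcont ((hAs n).continuous.mul (hBd n)))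
    rw [← integral_add i1 i2,
      ← integral_eq_setIntegral_of_tsupport (tsupport_fderiv_apply_subset ℝ v),
      integral_fderiv_smul_eq_neg hφ hc (hAB n), integral_eq_setIntegral_of_tsupport subset_rfl]
    congr 2
    ext x
    have h1 := ((hAs n).differentiable (by simp) x).hasFDerivAt.mul
      ((hBs n).differentiable (by simp) x).hasFDerivAt
    have h2 : HasFDerivAt (fun x => A n x * B n x) _ x := h1
    rw [h2.fderiv, ← smul_add]
    congr 1
    simp [mul_comm, add_comm]
  rw [integral_eq_setIntegral_of_tsupport (K := K) (tsupport_fderiv_apply_subset ℝ v),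
    integral_eq_setIntegral_of_tsupport (φ := φ) (K := K) subset_rfl]
  simp only [smul_add]
  rw [integral_add (hφK (hmul ha.locInt_deriv hb.locInt hM' K hs hc))
    (hφK (hmul ha.locInt hb.locInt_deriv hM K hs hc))]
  exact tendsto_nhds_unique lim1 ((lim2.add lim3).neg.congr fun n => (hsmooth n).symm)

end WeakCalculus

/-! ### Sector estimates for pairs of real bilinear forms. -/

section Sector

theorem abs_im_le_of_mem_complexSector {θ : ℝ} (hθ : θ < Real.pi / 2) {z : ℂ}
    (hz : z ∈ complexSector θ) : Real.cos θ * |z.im| ≤ Real.sin θ * z.re := by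
  obtain ⟨r, β, hr, hβ, rfl⟩ := hz
  have h1 : (((r : ℂ) * Complex.exp (Complex.I * (β : ℂ)))).re = r * Real.cos β := by
    rw [mul_comm Complex.I, Complex.re_ofReal_mul, Complex.exp_ofReal_mul_I_re]
  have h2 : (((r : ℂ) * Complex.exp (Complex.I * (β : ℂ)))).im = r * Real.sin β := by
    rw [mul_comm Complex.I, Complex.im_ofReal_mul, Complex.exp_ofReal_mul_I_im]
  rw [h1, h2, abs_mul, abs_of_nonneg hr]
  have hb := abs_le.1 hβ
  have h3 : 0 ≤ Real.sin (θ - β) := Real.sin_nonneg_of_nonneg_of_le_pi (by linarith) (by linarith)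
  have h4 : 0 ≤ Real.sin (θ + β) := Real.sin_nonneg_of_nonneg_of_le_pi (by linarith) (by linarith)
  rw [Real.sin_sub] at h3
  rw [Real.sin_add] at h4
  have h5 : Real.cos θ * |Real.sin β| ≤ Real.sin θ * Real.cos β := by
    rcases abs_cases (Real.sin β) with h | h <;> rw [h.1] <;> nlinarith
  nlinarith [mul_le_mul_of_nonneg_left h5 hr]

variable {W : Type*} [AddCommGroup W] [Module ℝ W]

/-- Put `β = φ - θ` and let `P`, `S` be the real and imaginary parts of `e^{iβ} (R + iB)`. Since
`[-θ, θ] + β ⊆ [-φ, φ]`, one has `cos φ |S(z,z)| ≤ sin φ P(z,z)`. The claim is `P(x,x) + P(y,y) - κ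
S(x,y) ≥ 0`, which follows by polarization at `x ± y` because `sin φ |κ| = 2 cos φ`. -/
theorem sector_bound_symm_aux {R B : W →ₗ[ℝ] W →ₗ[ℝ] ℝ} {θ φ κ : ℝ} (hθ0 : 0 ≤ θ) (hθφ : θ < φ)
    (hφ : φ ≤ Real.pi / 2)
    (hRs : ∀ x y, R x y = R y x) (hBs : ∀ x y, B x y = B y x) (hR : ∀ x, 0 ≤ R x x)
    (hRB : ∀ x, Real.cos θ * |B x x| ≤ Real.sin θ * R x x)
    (hκ : Real.sin φ * |κ| = 2 * Real.cos φ) (x y : W) :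
    Real.sin (φ - θ) * (B x x + B y y + κ * R x y) ≤
      Real.cos (φ - θ) * (R x x + R y y - κ * B x y) := by
  set β := φ - θ with hβ
  have hsφ : 0 < Real.sin φ := Real.sin_pos_of_pos_of_lt_pi (by linarith) (by linarith [Real.pi_pos])
  have hcθ : 0 < Real.cos θ := Real.cos_pos_of_mem_Ioo ⟨by linarith, by linarith⟩
  have hcφ : 0 ≤ Real.cos φ := Real.cos_nonneg_of_mem_Icc ⟨by linarith, by linarith⟩
  -- This side is sharp: the expression equals `sin θ R(z,z) - cos θ B(z,z)`.
  have k1 : ∀ z, 0 ≤ Real.sin φ * (Real.cos β * R z z - Real.sin β * B z z)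
      - Real.cos φ * (Real.sin β * R z z + Real.cos β * B z z) := by
    intro z
    have e1 : Real.sin φ * Real.cos β - Real.cos φ * Real.sin β = Real.sin θ := by
      rw [← Real.sin_sub, hβ]; congr 1; ring
    have e2 : Real.cos φ * Real.cos β + Real.sin φ * Real.sin β = Real.cos θ := by
      rw [← Real.cos_sub, hβ]; congr 1; ring
    have : Real.cos θ * B z z ≤ Real.sin θ * R z z :=
      (mul_le_mul_of_nonneg_left (le_abs_self _) hcθ.le).trans (hRB z)
    rw [← e1, ← e2] at this
    linarith
  -- The other edge of the sector: the expression is `sin (φ+β) R(z,z) + cos (φ+β) B(z,z)`,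
  -- nonnegative as `θ ≤ φ + β ≤ π - θ`.
  have k2 : ∀ z, 0 ≤ Real.sin φ * (Real.cos β * R z z - Real.sin β * B z z)
      + Real.cos φ * (Real.sin β * R z z + Real.cos β * B z z) := by
    intro z
    have e1 : Real.sin φ * Real.cos β + Real.cos φ * Real.sin β = Real.sin (φ + β) := by
      rw [← Real.sin_add]
    have e2 : Real.cos φ * Real.cos β - Real.sin φ * Real.sin β = Real.cos (φ + β) := by
      rw [← Real.cos_add]
    have h3 : 0 ≤ Real.sin (φ + β - θ) :=
      Real.sin_nonneg_of_nonneg_of_le_pi (by linarith) (by linarith)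
    have h4 : 0 ≤ Real.sin (φ + β + θ) :=
      Real.sin_nonneg_of_nonneg_of_le_pi (by linarith) (by linarith)
    rw [Real.sin_sub] at h3
    rw [Real.sin_add] at h4
    have h5 : |Real.cos (φ + β)| * Real.sin θ ≤ Real.sin (φ + β) * Real.cos θ := by
      rcases abs_cases (Real.cos (φ + β)) with h | h <;> rw [h.1] <;> linarith
    have h6 : -(|Real.cos (φ + β)| * (Real.sin θ * R z z)) ≤
        Real.cos θ * (Real.cos (φ + β) * B z z) := by
      have := mul_le_mul_of_nonneg_left (hRB z) (abs_nonneg (Real.cos (φ + β)))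
      have h7 := neg_abs_le (Real.cos (φ + β) * B z z)
      rw [abs_mul] at h7
      have h8 := mul_le_mul_of_nonneg_left h7 hcθ.le
      linarith
    have h7 := mul_le_mul_of_nonneg_right h5 (hR z)
    have h8 : 0 ≤ Real.cos θ * (Real.sin (φ + β) * R z z + Real.cos (φ + β) * B z z) := by linarith
    have h9 := nonneg_of_mul_nonneg_right h8 hcθ
    rw [← e1, ← e2] at h9
    linarith
  have hexp : ∀ (M : W →ₗ[ℝ] W →ₗ[ℝ] ℝ), (∀ a b, M a b = M b a) →
      M (x + y) (x + y) = M x x + M y y + 2 * M x y ∧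
      M (x - y) (x - y) = M x x + M y y - 2 * M x y := by
    intro M hM
    constructor
    · simp only [map_add, LinearMap.add_apply, hM y x]; ring
    · simp only [map_sub, LinearMap.sub_apply, hM y x]; ring
  obtain ⟨r1, r2⟩ := hexp R hRs
  obtain ⟨b1, b2⟩ := hexp B hBs
  have p1 := k1 (x + y)
  have p2 := k2 (x + y)
  have m1 := k1 (x - y)
  have m2 := k2 (x - y)
  rw [r1, b1] at p1 p2
  rw [r2, b2] at m1 m2
  rcases abs_cases κ with h | h <;> rw [h.1] at hκ
  · have : 0 ≤ Real.sin φ * (Real.cos β * (R x x + R y y - κ * B x y)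
        - Real.sin β * (B x x + B y y + κ * R x y)) := by
      have e : Real.sin φ * (Real.cos β * (R x x + R y y - κ * B x y)
        - Real.sin β * (B x x + B y y + κ * R x y)) =
        Real.sin φ * (Real.cos β * (R x x + R y y) - Real.sin β * (B x x + B y y))
        - (Real.sin φ * κ) * (Real.sin β * R x y + Real.cos β * B x y) := by ring
      rw [e, hκ]
      linarith
    linarith [nonneg_of_mul_nonneg_right this hsφ]
  · have : 0 ≤ Real.sin φ * (Real.cos β * (R x x + R y y - κ * B x y)
        - Real.sin β * (B x x + B y y + κ * R x y)) := by
      have e : Real.sin φ * (Real.cos β * (R x x + R y y - κ * B x y)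
        - Real.sin β * (B x x + B y y + κ * R x y)) =
        Real.sin φ * (Real.cos β * (R x x + R y y) - Real.sin β * (B x x + B y y))
        + (Real.sin φ * -κ) * (Real.sin β * R x y + Real.cos β * B x y) := by ring
      rw [e, hκ]
      linarith
    linarith [nonneg_of_mul_nonneg_right this hsφ]

theorem sector_bound_symm {R B : W →ₗ[ℝ] W →ₗ[ℝ] ℝ} {θ φ κ : ℝ} (hθ0 : 0 ≤ θ) (hθφ : θ < φ)
    (hφ : φ ≤ Real.pi / 2)
    (hRs : ∀ x y, R x y = R y x) (hBs : ∀ x y, B x y = B y x) (hR : ∀ x, 0 ≤ R x x)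
    (hRB : ∀ x, Real.cos θ * |B x x| ≤ Real.sin θ * R x x)
    (hκ : Real.sin φ * |κ| = 2 * Real.cos φ) (x y : W) :
    |B x x + B y y + κ * R x y| ≤
      Real.tan (Real.pi / 2 - φ + θ) * (R x x + R y y - κ * B x y) := by
  have h1 := sector_bound_symm_aux hθ0 hθφ hφ hRs hBs hR hRB hκ x y
  -- Changing the signs of `B` and `κ` is complex conjugation: the real part stays and the imaginary
  -- part changes sign.
  have h2 := sector_bound_symm_aux (B := -B) (κ := -κ) hθ0 hθφ hφ hRs
    (fun x y => by simp [hBs x y]) hR (fun x => by simpa using hRB x) (by simpa using hκ) x y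
  simp only [LinearMap.neg_apply] at h2
  have hs : 0 < Real.sin (φ - θ) :=
    Real.sin_pos_of_pos_of_lt_pi (by linarith) (by linarith [Real.pi_pos])
  have e : Real.tan (Real.pi / 2 - φ + θ) = Real.cos (φ - θ) / Real.sin (φ - θ) := by
    rw [show Real.pi / 2 - φ + θ = Real.pi / 2 - (φ - θ) by ring, Real.tan_pi_div_two_sub,
      Real.tan_eq_sin_div_cos, inv_div]
  rw [e, div_mul_eq_mul_div, le_div_iff₀ hs, mul_comm, ← abs_of_pos hs, ← abs_mul, abs_le]
  constructor <;> linarith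

/-- With `N = R(x,x) + R(y,y)`, `T = tan θ`, `c = cot φ`, the real part is at least `(1 - T c) N`
and the imaginary part at most `((ν - 1) T + c) N` in modulus; the constant is the quotient. The
denominator is positive because `θ < φ`. -/
theorem sector_bound_general {R B : W →ₗ[ℝ] W →ₗ[ℝ] ℝ} {θ φ κ ν : ℝ} (hθ0 : 0 ≤ θ) (hθφ : θ < φ)
    (hφ : φ ≤ Real.pi / 2) (hBs : ∀ x y, B x y = B y x) (hR : ∀ x, 0 ≤ R x x)
    (hRB : ∀ x y, Real.cos θ * |B x x + B y y + (R y x - R x y)| ≤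
      Real.sin θ * (R x x + R y y))
    (hκ : Real.sin φ * |κ| = 2 * Real.cos φ) (hν : Real.sin φ * ν = 2) (x y : W) :
    |B x x + B y y + κ * ((R x y + R y x) / 2) + ν * ((R y x - R x y) / 2)| ≤
      (((2 / Real.sin φ - 1) * Real.tan θ + Real.cot φ) /
          (1 - Real.tan θ * Real.cot φ)) * (R x x + R y y - κ * B x y) := by
  have hsφ : 0 < Real.sin φ := Real.sin_pos_of_pos_of_lt_pi (by linarith) (by linarith [Real.pi_pos])
  have hcθ : 0 < Real.cos θ := Real.cos_pos_of_mem_Ioo ⟨by linarith, by linarith⟩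
  have hcφ : 0 ≤ Real.cos φ := Real.cos_nonneg_of_mem_Icc ⟨by linarith, by linarith⟩
  have hsθ : 0 ≤ Real.sin θ := Real.sin_nonneg_of_nonneg_of_le_pi hθ0 (by linarith)
  set T := Real.tan θ with hT
  have hT' : T = Real.sin θ / Real.cos θ := Real.tan_eq_sin_div_cos θ
  set c := Real.cot φ with hc
  have hc' : c = Real.cos φ / Real.sin φ := Real.cot_eq_cos_div_sin φ
  have hT0 : 0 ≤ T := by rw [hT']; positivity
  have hc0 : 0 ≤ c := by rw [hc']; positivity
  have hκ' : |κ| = 2 * c := by rw [hc']; field_simp; linarith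
  have hν' : ν = 2 / Real.sin φ := by field_simp; linarith
  have hν2 : 2 ≤ ν := by
    rw [hν', le_div_iff₀ hsφ]; linarith [Real.sin_le_one φ]
  have hTc : 0 < 1 - T * c := by
    have : T * c < 1 := by
      rw [hT', hc', div_mul_div_comm, div_lt_one (by positivity)]
      have := Real.sin_pos_of_pos_of_lt_pi (x := φ - θ) (by linarith) (by linarith [Real.pi_pos])
      rw [Real.sin_sub] at this
      linarith
    linarith
  have hRB' : ∀ x y, |B x x + B y y + (R y x - R x y)| ≤ T * (R x x + R y y) := by
    intro x y
    rw [hT', div_mul_eq_mul_div, le_div_iff₀ hcθ]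
    linarith [hRB x y]
  have hexp : ∀ (M : W →ₗ[ℝ] W →ₗ[ℝ] ℝ),
      M (x + y) (x + y) = M x x + M y y + (M x y + M y x) ∧
      M (x - y) (x - y) = M x x + M y y - (M x y + M y x) := by
    intro M
    constructor
    · simp only [map_add, LinearMap.add_apply]; ring
    · simp only [map_sub, LinearMap.sub_apply]; ring
  set N := R x x + R y y with hN
  have hN0 : 0 ≤ N := add_nonneg (hR x) (hR y)
  have hs : |(R x y + R y x) / 2| ≤ N / 2 := by
    have h1 := hR (x + y)
    have h2 := hR (x - y)
    rw [(hexp R).1] at h1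
    rw [(hexp R).2] at h2
    rw [abs_le]; constructor <;> linarith
  have hb : |B x y| ≤ T * N / 2 := by
    have h1 := hRB' (x + y) 0
    have h2 := hRB' (x - y) 0
    simp only [map_zero, LinearMap.zero_apply, add_zero, sub_zero] at h1 h2
    rw [(hexp R).1, (hexp B).1, hBs y x] at h1
    rw [(hexp R).2, (hexp B).2, hBs y x] at h2
    have h1' := abs_le.1 h1
    have h2' := abs_le.1 h2
    rw [abs_le]; constructor <;> linarith
  have ha1 := abs_le.1 (hRB' x y)
  have ha2 := abs_le.1 (hRB' y x)
  have hTN : 0 ≤ T * N := mul_nonneg hT0 hN0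
  -- Write `b = B(x,x) + B(y,y)` and let `a` be the antisymmetric term. Exchanging `x` and `y` in
  -- the hypothesis gives `|b ± 2a| ≤ T N`, hence `|b + ν a| ≤ (ν/2) T N`; this is weakened to `(ν -
  -- 1) T N` by `ν ≥ 2`.
  have him : |B x x + B y y + ν * ((R y x - R x y) / 2)| ≤ (ν - 1) * (T * N) := by
    rw [← hN] at ha1
    rw [add_comm (R y y), ← hN] at ha2
    set a := (R y x - R x y) / 2 with ha
    have e1 : R y x - R x y = 2 * a := by rw [ha]; ring
    have e2 : R x y - R y x = -(2 * a) := by rw [ha]; ring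
    rw [e1] at ha1
    rw [e2] at ha2
    have q1 : 0 ≤ (ν - 2) * (T * N / 2 - a) := mul_nonneg (by linarith) (by linarith)
    have q2 : 0 ≤ (ν - 2) * (T * N / 2 + a) := mul_nonneg (by linarith) (by linarith)
    have q3 : 0 ≤ (ν - 2) * (T * N) := mul_nonneg (by linarith) hTN
    rw [abs_le]
    constructor <;> linarith
  have hκs : |κ * ((R x y + R y x) / 2)| ≤ c * N := by
    rw [abs_mul, hκ']
    linarith [mul_le_mul_of_nonneg_left hs hc0]
  have hκb : κ * B x y ≤ c * (T * N) := by
    have h1 := le_abs_self (κ * B x y)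
    rw [abs_mul, hκ'] at h1
    linarith [mul_le_mul_of_nonneg_left hb hc0]
  have hK : 0 ≤ (ν - 1) * T + c := by
    have := mul_nonneg (show 0 ≤ ν - 1 by linarith) hT0
    linarith
  rw [← hν', div_mul_eq_mul_div, le_div_iff₀ hTc]
  have hre : (1 - T * c) * N ≤ N - κ * B x y := by linarith
  have him' : |B x x + B y y + κ * ((R x y + R y x) / 2) + ν * ((R y x - R x y) / 2)| ≤
      ((ν - 1) * T + c) * N := by
    have := abs_add_le (B x x + B y y + ν * ((R y x - R x y) / 2)) (κ * ((R x y + R y x) / 2))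
    rw [show B x x + B y y + ν * ((R y x - R x y) / 2) + κ * ((R x y + R y x) / 2) =
      B x x + B y y + κ * ((R x y + R y x) / 2) + ν * ((R y x - R x y) / 2) by ring] at this
    linarith
  calc _ ≤ ((ν - 1) * T + c) * N * (1 - T * c) := mul_le_mul_of_nonneg_right him' hTc.le
    _ = ((ν - 1) * T + c) * ((1 - T * c) * N) := by ring
    _ ≤ _ := mul_le_mul_of_nonneg_left hre hK

end Sector

/-! ### The pointwise estimate for the regularized energy density. -/

noncomputable section PointwiseEstimate

open scoped ComplexConjugate

/-- The form `∑_{k,l} c_{kl} w_k conj(z_l)`. -/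
def gradForm {d : ℕ} (c : Matrix (Fin d) (Fin d) ℂ) (w z : Fin d → ℂ) : ℂ :=
  ∑ k, ∑ l, c k l * w k * conj (z l)

/-- The derivative at `z` in direction `w` of `z ↦ (|z|² + δ)^{(p-2)/2} z`. -/
def regDeriv (p δ : ℝ) (z w : ℂ) : ℂ :=
  (((‖z‖ ^ 2 + δ) ^ ((p - 2) / 2) : ℝ) : ℂ) * w +
    (((p - 2) * (‖z‖ ^ 2 + δ) ^ ((p - 2) / 2 - 1) * (conj z * w).re : ℝ) : ℂ) * z

theorem re_nonneg_of_mem_complexSector {θ : ℝ} (hθ : θ < Real.pi / 2) {z : ℂ}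
    (hz : z ∈ complexSector θ) : 0 ≤ z.re := by
  obtain ⟨r, β, hr, hβ, rfl⟩ := hz
  rw [mul_comm Complex.I, Complex.re_ofReal_mul, Complex.exp_ofReal_mul_I_re]
  have hb := abs_le.1 hβ
  exact mul_nonneg hr (Real.cos_nonneg_of_mem_Icc ⟨by linarith, by linarith⟩)

variable {d : ℕ} {c : Matrix (Fin d) (Fin d) ℂ}

/-- The real bilinear form with matrix `Re c`. -/
def reBilin (c : Matrix (Fin d) (Fin d) ℂ) : (Fin d → ℝ) →ₗ[ℝ] (Fin d → ℝ) →ₗ[ℝ] ℝ :=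
  Matrix.toLinearMap₂' ℝ (c.map Complex.re)

/-- The real bilinear form with matrix `Im c`. -/
def imBilin (c : Matrix (Fin d) (Fin d) ℂ) : (Fin d → ℝ) →ₗ[ℝ] (Fin d → ℝ) →ₗ[ℝ] ℝ :=
  Matrix.toLinearMap₂' ℝ (c.map Complex.im)

theorem reBilin_apply (x y : Fin d → ℝ) :
    reBilin c x y = ∑ k, ∑ l, (c k l).re * x k * y l := by
  simp only [reBilin, Matrix.toLinearMap₂'_apply, smul_eq_mul, Matrix.map_apply]
  exact Finset.sum_congr rfl fun k _ => Finset.sum_congr rfl fun l _ => by ring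

theorem imBilin_apply (x y : Fin d → ℝ) :
    imBilin c x y = ∑ k, ∑ l, (c k l).im * x k * y l := by
  simp only [imBilin, Matrix.toLinearMap₂'_apply, smul_eq_mul, Matrix.map_apply]
  exact Finset.sum_congr rfl fun k _ => Finset.sum_congr rfl fun l _ => by ring

theorem bilin_symm_of_antisymmPart_eq_zero {M : Matrix (Fin d) (Fin d) ℝ}
    (hM : antisymmPart M = 0) (k l : Fin d) : M k l = M l k := by
  have h := congrFun (congrFun hM k) l
  simp only [antisymmPart, Matrix.smul_apply, Matrix.sub_apply, Matrix.transpose_apply,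
    smul_eq_mul, Matrix.zero_apply] at h
  linarith

theorem reBilin_symm (h : reAntisymm c = 0) (x y : Fin d → ℝ) :
    reBilin c x y = reBilin c y x := by
  rw [reBilin_apply, reBilin_apply, Finset.sum_comm]
  refine Finset.sum_congr rfl fun k _ => Finset.sum_congr rfl fun l _ => ?_
  have : (c l k).re = (c k l).re := bilin_symm_of_antisymmPart_eq_zero h l k
  rw [this]; ring

theorem imBilin_symm (h : imAntisymm c = 0) (x y : Fin d → ℝ) :
    imBilin c x y = imBilin c y x := by
  rw [imBilin_apply, imBilin_apply, Finset.sum_comm]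
  refine Finset.sum_congr rfl fun k _ => Finset.sum_congr rfl fun l _ => ?_
  have : (c l k).im = (c k l).im := bilin_symm_of_antisymmPart_eq_zero h l k
  rw [this]; ring

theorem gradForm_re (q : ℝ) (x y : Fin d → ℝ) :
    (gradForm c (fun k => x k + y k * Complex.I) fun l => ((q * x l : ℝ) : ℂ) + y l * Complex.I).re
      = q * reBilin c x x + reBilin c y y - q * imBilin c y x + imBilin c x y := by
  simp only [gradForm, reBilin_apply, imBilin_apply, Complex.re_sum, Finset.mul_sum,
    ← Finset.sum_add_distrib, ← Finset.sum_sub_distrib]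
  refine Finset.sum_congr rfl fun k _ => Finset.sum_congr rfl fun l _ => ?_
  simp
  ring

theorem gradForm_im (q : ℝ) (x y : Fin d → ℝ) :
    (gradForm c (fun k => x k + y k * Complex.I) fun l => ((q * x l : ℝ) : ℂ) + y l * Complex.I).im
      = q * imBilin c x x + imBilin c y y + q * reBilin c y x - reBilin c x y := by
  simp only [gradForm, reBilin_apply, imBilin_apply, Complex.im_sum, Finset.mul_sum,
    ← Finset.sum_add_distrib, ← Finset.sum_sub_distrib]
  refine Finset.sum_congr rfl fun k _ => Finset.sum_congr rfl fun l _ => ?_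
  simp
  ring

/-- The conjugation accounts for the transposed index convention: `gradForm` pairs the first index
with the unconjugated vector, `matrixForm` the second. -/
theorem gradForm_self (w : Fin d → ℂ) :
    gradForm c w w = matrixForm c (fun k => conj (w k)) := by
  simp only [gradForm, matrixForm, Matrix.mulVec, dotProduct, Finset.sum_mul]
  refine Finset.sum_congr rfl fun k _ => Finset.sum_congr rfl fun l _ => ?_
  rw [Complex.conj_conj]
  ring

/-- The sector condition at the complex vector with real part `x` and imaginary part `y`, up to
conjugation; symmetry of `B` removes the mixed `B` terms from the real part. -/
theorem bilin_sector {θ : ℝ} (hθ : θ < Real.pi / 2)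
    (hs : ∀ ξ : Fin d → ℂ, matrixForm c ξ ∈ complexSector θ) (hB : imAntisymm c = 0)
    (x y : Fin d → ℝ) :
    Real.cos θ * |imBilin c x x + imBilin c y y + (reBilin c y x - reBilin c x y)| ≤
      Real.sin θ * (reBilin c x x + reBilin c y y) ∧ 0 ≤ reBilin c x x + reBilin c y y := by
  have h := hs fun k => conj ((x k : ℂ) + y k * Complex.I)
  rw [← gradForm_self] at h
  have h1 := abs_im_le_of_mem_complexSector hθ h
  have h2 := re_nonneg_of_mem_complexSector hθ h
  have e1 := gradForm_re (c := c) 1 x y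
  have e2 := gradForm_im (c := c) 1 x y
  simp only [one_mul] at e1 e2
  rw [e1, e2] at h1
  rw [e1] at h2
  rw [imBilin_symm hB x y] at h1 h2
  simp only [sub_add_cancel] at h1 h2
  rw [add_sub_assoc] at h1
  exact ⟨h1, h2⟩

theorem reBilin_self_nonneg {θ : ℝ} (hθ : θ < Real.pi / 2)
    (hs : ∀ ξ : Fin d → ℂ, matrixForm c ξ ∈ complexSector θ) (hB : imAntisymm c = 0)
    (x : Fin d → ℝ) : 0 ≤ reBilin c x x := by
  simpa using (bilin_sector hθ hs hB x 0).2

theorem gradForm_self_bound {θ K : ℝ} (hθ : θ < Real.pi / 2) (hθ0 : 0 ≤ θ)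
    (hs : ∀ ξ : Fin d → ℂ, matrixForm c ξ ∈ complexSector θ) (hK : Real.tan θ ≤ K)
    (w : Fin d → ℂ) : |(gradForm c w w).im| ≤ K * (gradForm c w w).re := by
  rw [gradForm_self]
  have h := hs fun k => conj (w k)
  have h1 := abs_im_le_of_mem_complexSector hθ h
  have h2 := re_nonneg_of_mem_complexSector hθ h
  have hcθ : 0 < Real.cos θ := Real.cos_pos_of_mem_Ioo ⟨by linarith, by linarith⟩
  refine le_trans ?_ (mul_le_mul_of_nonneg_right hK h2)
  rw [Real.tan_eq_sin_div_cos, div_mul_eq_mul_div, le_div_iff₀ hcθ]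
  linarith

/-- The quantities `κ` and `ν` of the rescaled form in terms of `φ = arccos |1 - 2 / p|`. -/
theorem arccos_relations {p θ φ : ℝ} (hp : 1 < p) (hθ0 : 0 ≤ θ) (hθ : θ < Real.pi / 2)
    (hpθ : |1 - 2 / p| < Real.cos θ) (hφ : φ = Real.arccos |1 - 2 / p|) :
    θ < φ ∧ φ ≤ Real.pi / 2 ∧
      Real.sin φ * |(p - 2) / √(p - 1)| = 2 * Real.cos φ ∧ Real.sin φ * (p / √(p - 1)) = 2 := by
  have h0 := abs_nonneg (1 - 2 / p)
  have h1 : |1 - 2 / p| ≤ 1 := hpθ.le.trans (Real.cos_le_one θ)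
  have hm : 0 < √(p - 1) := Real.sqrt_pos.2 (by linarith)
  have hm2 : √(p - 1) ^ 2 = p - 1 := Real.sq_sqrt (by linarith)
  have hcos : Real.cos φ = |1 - 2 / p| := by rw [hφ, Real.cos_arccos (by linarith) h1]
  have e : 1 - 2 / p = (p - 2) / p := by field_simp
  have hsin : Real.sin φ = 2 * √(p - 1) / p := by
    rw [hφ, Real.sin_arccos, sq_abs, Real.sqrt_eq_iff_mul_self_eq_of_pos (by positivity)]
    have : (2 * √(p - 1) / p) * (2 * √(p - 1) / p) = 4 * √(p - 1) ^ 2 / p ^ 2 := by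
      field_simp; ring
    rw [this, hm2]
    field_simp
    ring
  refine ⟨?_, ?_, ?_, ?_⟩
  · rw [hφ, ← Real.arccos_cos hθ0 (by linarith)]
    exact Real.arccos_lt_arccos (by linarith) hpθ (Real.cos_le_one θ)
  · rw [hφ]; exact Real.arccos_le_pi_div_two.2 h0
  · rw [hcos, hsin, e, abs_div, abs_div, abs_of_pos hm, abs_of_pos (by linarith : (0 : ℝ) < p)]
    field_simp
  · rw [hsin]; field_simp

/-- Scaling by `√(p-1)` absorbs the weight `p - 1` of the diagonal terms. The coefficients `p - 1`
and `-1` of `R(y,x)` and `R(x,y)` split into symmetric and antisymmetric parts, which gives `p - 2`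
and `p`. -/
theorem gradForm_rescaled {p : ℝ} (hp : 1 < p) (hB : imAntisymm c = 0) (x y : Fin d → ℝ) :
    let x' : Fin d → ℝ := √(p - 1) • x
    (gradForm c (fun k => x k + y k * Complex.I)
        fun l => (((p - 1) * x l : ℝ) : ℂ) + y l * Complex.I).re
      = reBilin c x' x' + reBilin c y y - (p - 2) / √(p - 1) * imBilin c x' y ∧
    (gradForm c (fun k => x k + y k * Complex.I)
        fun l => (((p - 1) * x l : ℝ) : ℂ) + y l * Complex.I).im
      = imBilin c x' x' + imBilin c y y
        + (p - 2) / √(p - 1) * ((reBilin c x' y + reBilin c y x') / 2)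
        + p / √(p - 1) * ((reBilin c y x' - reBilin c x' y) / 2) := by
  have hm : 0 < √(p - 1) := Real.sqrt_pos.2 (by linarith)
  have hm2 : √(p - 1) * √(p - 1) = p - 1 := Real.mul_self_sqrt (by linarith)
  simp only
  rw [gradForm_re, gradForm_im, imBilin_symm hB y x]
  simp only [map_smul, LinearMap.smul_apply, smul_eq_mul, ← mul_assoc, hm2]
  constructor
  · rw [div_mul_cancel₀ _ hm.ne']; ring
  · have e1 : ∀ a b s : ℝ, a / √(p - 1) * ((√(p - 1) * s + √(p - 1) * b) / 2) = a * (s + b) / 2 := by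
      intro a b s; field_simp
    have e2 : ∀ a b s : ℝ, a / √(p - 1) * ((√(p - 1) * s - √(p - 1) * b) / 2) = a * (s - b) / 2 := by
      intro a b s; field_simp
    rw [e1, e2]
    ring

theorem gradForm_bound_symm {p θ φ : ℝ} (hp : 1 < p) (hθ0 : 0 ≤ θ) (hθ : θ < Real.pi / 2)
    (hpθ : |1 - 2 / p| < Real.cos θ) (hφ : φ = Real.arccos |1 - 2 / p|)
    (hs : ∀ ξ : Fin d → ℂ, matrixForm c ξ ∈ complexSector θ) (hB : imAntisymm c = 0)
    (hR : reAntisymm c = 0) (x y : Fin d → ℝ) :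
    |(gradForm c (fun k => x k + y k * Complex.I)
        fun l => (((p - 1) * x l : ℝ) : ℂ) + y l * Complex.I).im| ≤
      Real.tan (Real.pi / 2 - φ + θ) * (gradForm c (fun k => x k + y k * Complex.I)
        fun l => (((p - 1) * x l : ℝ) : ℂ) + y l * Complex.I).re := by
  obtain ⟨h1, h2, h3, -⟩ := arccos_relations hp hθ0 hθ hpθ hφ
  obtain ⟨e1, e2⟩ := gradForm_rescaled hp hB x y
  rw [e1, e2, reBilin_symm hR y, sub_self, zero_div, mul_zero, add_zero, add_self_div_two]
  exact sector_bound_symm hθ0 h1 h2 (reBilin_symm hR) (imBilin_symm hB)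
    (reBilin_self_nonneg hθ hs hB) (fun z => by simpa using (bilin_sector hθ hs hB z 0).1) h3 _ _

theorem gradForm_bound_general {p θ φ : ℝ} (hp : 1 < p) (hθ0 : 0 ≤ θ) (hθ : θ < Real.pi / 2)
    (hpθ : |1 - 2 / p| < Real.cos θ) (hφ : φ = Real.arccos |1 - 2 / p|)
    (hs : ∀ ξ : Fin d → ℂ, matrixForm c ξ ∈ complexSector θ) (hB : imAntisymm c = 0)
    (x y : Fin d → ℝ) :
    |(gradForm c (fun k => x k + y k * Complex.I)
        fun l => (((p - 1) * x l : ℝ) : ℂ) + y l * Complex.I).im| ≤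
      (((2 / Real.sin φ - 1) * Real.tan θ + Real.cot φ) / (1 - Real.tan θ * Real.cot φ)) *
        (gradForm c (fun k => x k + y k * Complex.I)
        fun l => (((p - 1) * x l : ℝ) : ℂ) + y l * Complex.I).re := by
  obtain ⟨h1, h2, h3, h4⟩ := arccos_relations hp hθ0 hθ hpθ hφ
  obtain ⟨e1, e2⟩ := gradForm_rescaled hp hB x y
  rw [e1, e2]
  exact sector_bound_general hθ0 h1 h2 (imBilin_symm hB)
    (reBilin_self_nonneg hθ hs hB) (fun z w => (bilin_sector hθ hs hB z w).1) h3 h4 _ _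

theorem tan_le_tan_symm_constant {θ φ : ℝ} (hθ0 : 0 ≤ θ) (hθφ : θ < φ) (hφ : φ ≤ Real.pi / 2) :
    Real.tan θ ≤ Real.tan (Real.pi / 2 - φ + θ) := by
  rcases hφ.eq_or_lt with h | h
  · rw [h, sub_self, zero_add]
  · exact (Real.tan_lt_tan_of_lt_of_lt_pi_div_two (by linarith [Real.pi_pos]) (by linarith)
      (by linarith)).le

/-- Needed because the regularized density also contains the unweighted form, whose own constant is
`tan θ`. -/
theorem tan_le_general_constant {θ φ : ℝ} (hθ0 : 0 ≤ θ) (hθφ : θ < φ) (hφ : φ ≤ Real.pi / 2) :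
    Real.tan θ ≤
      ((2 / Real.sin φ - 1) * Real.tan θ + Real.cot φ) / (1 - Real.tan θ * Real.cot φ) := by
  have hsφ : 0 < Real.sin φ := Real.sin_pos_of_pos_of_lt_pi (by linarith) (by linarith [Real.pi_pos])
  have hcθ : 0 < Real.cos θ := Real.cos_pos_of_mem_Ioo ⟨by linarith, by linarith⟩
  have hcφ : 0 ≤ Real.cos φ := Real.cos_nonneg_of_mem_Icc ⟨by linarith, by linarith⟩
  have hsθ : 0 ≤ Real.sin θ := Real.sin_nonneg_of_nonneg_of_le_pi hθ0 (by linarith)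
  have hT0 : 0 ≤ Real.tan θ := by rw [Real.tan_eq_sin_div_cos]; positivity
  have hc0 : 0 ≤ Real.cot φ := by rw [Real.cot_eq_cos_div_sin]; positivity
  have hTc : 0 < 1 - Real.tan θ * Real.cot φ := by
    have : Real.tan θ * Real.cot φ < 1 := by
      rw [Real.tan_eq_sin_div_cos, Real.cot_eq_cos_div_sin, div_mul_div_comm,
        div_lt_one (by positivity)]
      have := Real.sin_pos_of_pos_of_lt_pi (x := φ - θ) (by linarith) (by linarith [Real.pi_pos])
      rw [Real.sin_sub] at this
      linarith
    linarith
  rw [le_div_iff₀ hTc]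
  have h1 : 1 ≤ 1 / Real.sin φ := by rw [le_div_iff₀ hsφ]; linarith [Real.sin_le_one φ]
  have h2 : 2 / Real.sin φ = 2 * (1 / Real.sin φ) := by ring
  have h3 : Real.tan θ * 1 ≤ Real.tan θ * (2 / Real.sin φ - 1) :=
    mul_le_mul_of_nonneg_left (by rw [h2]; linarith) hT0
  have h4 : 0 ≤ Real.tan θ * (Real.tan θ * Real.cot φ) := by positivity
  linarith

/-- With `z = |z| ω`, `w = ω (x + i y)` and `λ = |z|² / (|z|² + δ)`, the regularized derivative is a
nonnegative multiple of `ω ((1-λ) (x + i y) + λ ((p-1) x + i y))`. The values satisfying the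
estimate with constant `K` form a convex cone, so the cases `λ = 0` and `λ = 1` suffice. -/
theorem gradForm_regDeriv_bound {p δ K : ℝ} (hδ : 0 ≤ δ)
    (h1 : ∀ w : Fin d → ℂ, |(gradForm c w w).im| ≤ K * (gradForm c w w).re)
    (hq : ∀ x y : Fin d → ℝ, |(gradForm c (fun k => x k + y k * Complex.I)
        fun l => (((p - 1) * x l : ℝ) : ℂ) + y l * Complex.I).im| ≤
      K * (gradForm c (fun k => x k + y k * Complex.I)
        fun l => (((p - 1) * x l : ℝ) : ℂ) + y l * Complex.I).re)
    (z : ℂ) (w : Fin d → ℂ) :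
    |(gradForm c w fun l => regDeriv p δ z (w l)).im| ≤
      K * (gradForm c w fun l => regDeriv p δ z (w l)).re := by
  have hA0 : 0 ≤ ‖z‖ ^ 2 + δ := by positivity
  set s : ℝ := (‖z‖ ^ 2 + δ) ^ ((p - 2) / 2) with hs
  have hs0 : 0 ≤ s := Real.rpow_nonneg hA0 _
  obtain ⟨lam, hl0, hl1, w', e⟩ : ∃ lam : ℝ, 0 ≤ lam ∧ lam ≤ 1 ∧ ∃ x : (Fin d → ℝ) × (Fin d → ℝ),
      (gradForm c w fun l => regDeriv p δ z (w l)) = (s : ℂ) *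
        (((1 - lam : ℝ) : ℂ) * gradForm c w w + (lam : ℂ) *
          gradForm c (fun k => x.1 k + x.2 k * Complex.I)
            fun l => (((p - 1) * x.1 l : ℝ) : ℂ) + x.2 l * Complex.I) := by
    rcases eq_or_ne z 0 with hz | hz
    -- At `z = 0` there is no phase, but the second term of the derivative vanishes, so `λ = 0`
    -- works.
    · refine ⟨0, le_rfl, zero_le_one, 0, ?_⟩
      have hD : ∀ l, regDeriv p δ z (w l) = s * w l := fun l => by
        rw [regDeriv, ← hs, hz, mul_zero, add_zero]
      simp only [hD, sub_zero, Complex.ofReal_one, one_mul, Complex.ofReal_zero, zero_mul, add_zero]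
      simp only [gradForm, Finset.mul_sum]
      refine Finset.sum_congr rfl fun k _ => Finset.sum_congr rfl fun l _ => ?_
      rw [map_mul, Complex.conj_ofReal]
      ring
    · have hr : 0 < ‖z‖ := norm_pos_iff.2 hz
      have hA : 0 < ‖z‖ ^ 2 + δ := by positivity
      set A := ‖z‖ ^ 2 + δ with hAdef
      set ω : ℂ := z / ‖z‖ with hω
      have hzω : z = ‖z‖ * ω := by
        rw [hω, mul_div_cancel₀]; exact_mod_cast hr.ne'
      have hωω : ω * conj ω = 1 := by
        rw [Complex.mul_conj, Complex.normSq_eq_norm_sq, hω, norm_div, Complex.norm_real,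
          norm_norm, div_self hr.ne']
        simp
      refine ⟨‖z‖ ^ 2 / A, by positivity, (div_le_one hA).2 (by linarith),
        (fun k => (conj ω * w k).re, fun k => (conj ω * w k).im), ?_⟩
      have hwk : ∀ k, w k = ω * (((conj ω * w k).re : ℂ) + (conj ω * w k).im * Complex.I) := by
        intro k
        rw [Complex.re_add_im, ← mul_assoc, hωω, one_mul]
      have alg : ∀ s A r a b : ℝ, A ≠ 0 → (s : ℂ) * (ω * (a + b * Complex.I)) +
          (((p - 2) * (s / A) * (r * a) : ℝ) : ℂ) * (r * ω) = (s : ℂ) * ω *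
          (((1 - r ^ 2 / A : ℝ) : ℂ) * (a + b * Complex.I) + ((r ^ 2 / A : ℝ) : ℂ) *
          ((((p - 1) * a : ℝ) : ℂ) + b * Complex.I)) := by
        intro s A r a b hA
        have hAc : (A : ℂ) ≠ 0 := by exact_mod_cast hA
        push_cast
        field_simp
        ring
      have hD : ∀ k, regDeriv p δ z (w k) = (s : ℂ) * ω * (((1 - ‖z‖ ^ 2 / A : ℝ) : ℂ) *
          (((conj ω * w k).re : ℂ) + (conj ω * w k).im * Complex.I) + ((‖z‖ ^ 2 / A : ℝ) : ℂ) *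
          ((((p - 1) * (conj ω * w k).re : ℝ) : ℂ) + (conj ω * w k).im * Complex.I)) := by
        intro k
        have e1 : (‖z‖ ^ 2 + δ) ^ ((p - 2) / 2 - 1) = s / A := by
          rw [Real.rpow_sub hA, Real.rpow_one]
        have e2 : (conj z * w k).re = ‖z‖ * (conj ω * w k).re := by
          conv_lhs => rw [hzω]
          rw [map_mul, Complex.conj_ofReal, mul_assoc, Complex.re_ofReal_mul]
        rw [regDeriv, e1, e2, ← hs]
        have h := alg s A ‖z‖ (conj ω * w k).re (conj ω * w k).im hA.ne'
        rwa [← hzω, ← hwk k] at h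
      simp only [gradForm, Finset.mul_sum, ← Finset.sum_add_distrib]
      refine Finset.sum_congr rfl fun k _ => Finset.sum_congr rfl fun l _ => ?_
      rw [hD l]
      generalize hX : (((conj ω * w k).re : ℂ) + (conj ω * w k).im * Complex.I) = X
      have hwk' : w k = ω * X := by rw [← hX]; exact hwk k
      have hwl' := hwk l
      generalize hY : (((conj ω * w l).re : ℂ) + (conj ω * w l).im * Complex.I) = Y at *
      generalize ((((p - 1) * (conj ω * w l).re : ℝ) : ℂ) + (conj ω * w l).im * Complex.I) = Z
      rw [hwk', hwl']
      simp only [map_mul, map_add, Complex.conj_ofReal]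
      linear_combination (c k l * X * s * ((1 - ‖z‖ ^ 2 / A : ℝ) * conj Y
        + (‖z‖ ^ 2 / A : ℝ) * conj Z) - (s : ℂ) * (1 - ‖z‖ ^ 2 / A : ℝ) * c k l * X * conj Y) * hωω
  rw [e]
  have a1 := h1 w
  have a2 := hq w'.1 w'.2
  generalize gradForm c w w = P at *
  generalize (gradForm c (fun k => (w'.1 k : ℂ) + w'.2 k * Complex.I)
            fun l => (((p - 1) * w'.1 l : ℝ) : ℂ) + w'.2 l * Complex.I) = Q at *
  rw [Complex.re_ofReal_mul, Complex.im_ofReal_mul, Complex.add_re, Complex.add_im,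
    Complex.re_ofReal_mul, Complex.im_ofReal_mul, Complex.re_ofReal_mul, Complex.im_ofReal_mul,
    abs_mul, abs_of_nonneg hs0]
  have b1 := abs_add_le ((1 - lam) * P.im) (lam * Q.im)
  rw [abs_mul, abs_mul, abs_of_nonneg hl0, abs_of_nonneg (by linarith : 0 ≤ 1 - lam)] at b1
  have b2 := mul_le_mul_of_nonneg_left a1 (by linarith : 0 ≤ 1 - lam)
  have b3 := mul_le_mul_of_nonneg_left a2 hl0
  calc _ ≤ s * ((1 - lam) * (K * P.re) + lam * (K * Q.re)) :=
        mul_le_mul_of_nonneg_left (by linarith) hs0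
    _ = _ := by ring

end PointwiseEstimate

/-! ### The regularized duality map and the truncation of the gradient. -/

noncomputable section Truncations

open Filter
open scoped Topology ContDiff ComplexConjugate RealInnerProductSpace

/-- The map `z ↦ (|z|² + δ)^{(p-2)/2} z`. -/
def regFun (p δ : ℝ) (z : ℂ) : ℂ := ((‖z‖ ^ 2 + δ) ^ ((p - 2) / 2)) • z

theorem contDiff_regFun (p : ℝ) {δ : ℝ} (hδ : 0 < δ) : ContDiff ℝ ∞ (regFun p δ) := by
  have h1 : ContDiff ℝ ∞ fun z : ℂ => ‖z‖ ^ 2 + δ := (contDiff_norm_sq ℝ).add contDiff_const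
  exact (h1.rpow_const_of_ne fun z => by positivity).smul contDiff_id

theorem fderiv_regFun (p : ℝ) {δ : ℝ} (hδ : 0 < δ) (z w : ℂ) :
    fderiv ℝ (regFun p δ) z w = regDeriv p δ z w := by
  have h1 : HasFDerivAt (fun z : ℂ => ‖z‖ ^ 2 + δ) (2 • innerSL ℝ z) z :=
    (hasStrictFDerivAt_norm_sq z).hasFDerivAt.add_const δ
  have h2 := (h1.rpow_const (p := (p - 2) / 2) (Or.inl (by positivity))).smul (hasFDerivAt_id z)
  have h3 : HasFDerivAt (regFun p δ) _ z := h2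
  rw [h3.fderiv, regDeriv]
  simp [Complex.inner, Complex.real_smul]
  ring_nf
  simp

theorem norm_regFun (p δ : ℝ) (hδ : 0 ≤ δ) (z : ℂ) :
    ‖regFun p δ z‖ = (‖z‖ ^ 2 + δ) ^ ((p - 2) / 2) * ‖z‖ := by
  rw [regFun, norm_smul, Real.norm_of_nonneg (Real.rpow_nonneg (by positivity) _)]

theorem regFun_zero_right (p δ : ℝ) : regFun p δ 0 = 0 := smul_zero _

theorem norm_sq_rpow (e : ℝ) (z : ℂ) : (‖z‖ ^ 2) ^ e = ‖z‖ ^ (2 * e) := by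
  rw [Real.rpow_mul (norm_nonneg z), Real.rpow_two]

/-- For `p ≤ 2` the exponent `(p-2)/2` is nonpositive, so adding `δ` only decreases the weight; for
`p > 2` it would increase it, hence `δ = 0` there. Independence of `δ` makes this the majorant in
all later limits. -/
theorem norm_regFun_le {p δ : ℝ} (hp : 1 < p) (h : p ≤ 2 ∧ 0 < δ ∨ 2 ≤ p ∧ δ = 0) (z : ℂ) :
    ‖regFun p δ z‖ ≤ ‖z‖ ^ (p - 1) := by
  have hδ : 0 ≤ δ := by rcases h with h | h <;> linarith [h.2]
  rcases eq_or_ne z 0 with rfl | hz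
  · rw [regFun_zero_right, norm_zero, Real.zero_rpow (by linarith)]
  have hr : 0 < ‖z‖ := norm_pos_iff.2 hz
  have h1 : (‖z‖ ^ 2 + δ) ^ ((p - 2) / 2) ≤ (‖z‖ ^ 2) ^ ((p - 2) / 2) := by
    rcases h with h | h
    · exact Real.rpow_le_rpow_of_nonpos (by positivity) (by linarith) (by linarith [h.1])
    · rw [h.2, add_zero]
  rw [norm_regFun p δ hδ]
  refine (mul_le_mul_of_nonneg_right h1 hr.le).trans (le_of_eq ?_)
  rw [norm_sq_rpow, mul_div_cancel₀ _ two_ne_zero]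
  nth_rw 2 [← Real.rpow_one ‖z‖]
  rw [← Real.rpow_add hr]
  congr 1; ring

theorem regFun_zero_eq_dualFun {d : ℕ} (p : ℝ) (u : RSpace d → ℂ) (x : RSpace d) :
    regFun p 0 (u x) = dualFun p u x := by
  rw [dualFun, regFun, add_zero, norm_sq_rpow, mul_div_cancel₀ _ two_ne_zero, Complex.real_smul]
  by_cases h : u x = 0
  · simp [h]
  · rw [Set.indicator_of_mem h]

theorem tendsto_regFun {ι : Type*} {l : Filter ι} {p δ : ℝ} {δ' : ι → ℝ} {z : ℂ} {z' : ι → ℂ}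
    (hδ : Tendsto δ' l (𝓝 δ)) (hz : Tendsto z' l (𝓝 z)) (h : ‖z‖ ^ 2 + δ ≠ 0 ∨ 2 ≤ p) :
    Tendsto (fun i => regFun p (δ' i) (z' i)) l (𝓝 (regFun p δ z)) :=
  (((hz.norm.pow 2).add hδ).rpow_const (h.imp_right fun h => by linarith)).smul hz

theorem norm_regDeriv_le (p : ℝ) {δ : ℝ} (hδ : 0 ≤ δ) (z w : ℂ) :
    ‖regDeriv p δ z w‖ ≤ (1 + |p - 2|) * (‖z‖ ^ 2 + δ) ^ ((p - 2) / 2) * ‖w‖ := by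
  have hA : 0 ≤ ‖z‖ ^ 2 + δ := by positivity
  have h1 : ‖regDeriv p δ z w‖ ≤ (‖z‖ ^ 2 + δ) ^ ((p - 2) / 2) * ‖w‖ +
      |p - 2| * (‖z‖ ^ 2 + δ) ^ ((p - 2) / 2 - 1) * (‖z‖ * ‖w‖) * ‖z‖ := by
    refine (norm_add_le _ _).trans (add_le_add ?_ ?_)
    · rw [norm_mul, Complex.norm_real, Real.norm_of_nonneg (Real.rpow_nonneg hA _)]
    · rw [norm_mul, Complex.norm_real, norm_mul, norm_mul,
        Real.norm_of_nonneg (Real.rpow_nonneg hA _), Real.norm_eq_abs]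
      have : ‖(conj z * w).re‖ ≤ ‖z‖ * ‖w‖ := by
        refine (Complex.abs_re_le_norm _).trans (le_of_eq ?_)
        rw [norm_mul, Complex.norm_conj]
      gcongr
  have h2 : (‖z‖ ^ 2 + δ) ^ ((p - 2) / 2 - 1) * ‖z‖ ^ 2 ≤ (‖z‖ ^ 2 + δ) ^ ((p - 2) / 2) := by
    rcases hA.eq_or_lt with h | h
    · have : ‖z‖ ^ 2 = 0 := by nlinarith [sq_nonneg ‖z‖]
      rw [this, mul_zero]
      exact Real.rpow_nonneg (by positivity) _
    · rw [Real.rpow_sub h, Real.rpow_one, div_mul_eq_mul_div, div_le_iff₀ h]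
      exact mul_le_mul_of_nonneg_left (by linarith) (Real.rpow_nonneg hA _)
  have h3 := mul_le_mul_of_nonneg_left h2 (mul_nonneg (abs_nonneg (p - 2)) (norm_nonneg w))
  linarith

/-- Only `z = 0`, `δ = 0` is delicate, and it forces `p ≥ 2`. For `p = 2` the map is the identity in
`w`; for `p > 2` the limit is zero and `norm_regDeriv_le` squeezes. -/
theorem tendsto_regDeriv {ι : Type*} {l : Filter ι} {p δ : ℝ} {δ' : ι → ℝ} {z w : ℂ}
    {z' w' : ι → ℂ} (hδ0 : ∀ i, 0 ≤ δ' i)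
    (hδ : Tendsto δ' l (𝓝 δ)) (hz : Tendsto z' l (𝓝 z)) (hw : Tendsto w' l (𝓝 w))
    (hδ1 : 0 ≤ δ) (h : 0 < δ ∨ 2 ≤ p) :
    Tendsto (fun i => regDeriv p (δ' i) (z' i) (w' i)) l (𝓝 (regDeriv p δ z w)) := by
  have hA : Tendsto (fun i => ‖z' i‖ ^ 2 + δ' i) l (𝓝 (‖z‖ ^ 2 + δ)) := (hz.norm.pow 2).add hδ
  by_cases h0 : ‖z‖ ^ 2 + δ = 0
  · have hz0 : z = 0 := by
      have : ‖z‖ ^ 2 = 0 := by nlinarith [sq_nonneg ‖z‖]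
      simpa using this
    have hδz : δ = 0 := by rw [hz0] at h0; simpa using h0
    have hp : 2 ≤ p := by rcases h with h | h <;> linarith
    rcases hp.eq_or_lt with hp | hp
    · have : ∀ δ z w, regDeriv p δ z w = w := fun δ z w => by simp [regDeriv, ← hp]
      simpa only [this] using hw
    · have e : regDeriv p δ z w = 0 := by
        rw [regDeriv, h0, Real.zero_rpow (by linarith), hz0]; simp
      rw [e]
      refine squeeze_zero_norm (fun i => norm_regDeriv_le p (hδ0 i) _ _) ?_
      have := ((hA.rpow_const (p := (p - 2) / 2) (Or.inr (by linarith))).const_mul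
        (1 + |p - 2|)).mul hw.norm
      rw [h0, Real.zero_rpow (by linarith)] at this
      simpa using this
  · have hc : Continuous fun z : ℂ => conj z := Complex.continuous_conj
    have h1 := (hA.rpow_const (p := (p - 2) / 2) (Or.inl h0))
    have h2 := (hA.rpow_const (p := (p - 2) / 2 - 1) (Or.inl h0))
    have h3 : Tendsto (fun i => (conj (z' i) * w' i).re) l (𝓝 (conj z * w).re) :=
      (Complex.continuous_re.tendsto _).comp (((hc.tendsto z).comp hz).mul hw)
    exact (((Complex.continuous_ofReal.tendsto _).comp h1).mul hw).add
      (((Complex.continuous_ofReal.tendsto _).comp ((h2.const_mul (p - 2)).mul h3)).mul hz)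

variable {E : Type*} [NormedAddCommGroup E] [InnerProductSpace ℝ E]

/-- The truncation `z ↦ z / (1 + ε |z|²)`. -/
def truncFun (ε : ℝ) (z : E) : E := (1 + ε * ‖z‖ ^ 2)⁻¹ • z

/-- The derivative of `truncFun ε` at `z` in direction `w`. -/
def truncDeriv (ε : ℝ) (z w : E) : E :=
  (1 + ε * ‖z‖ ^ 2)⁻¹ • w - ((1 + ε * ‖z‖ ^ 2)⁻¹ ^ 2 * (2 * ε * ⟪z, w⟫)) • z

theorem contDiff_truncFun {ε : ℝ} (hε : 0 ≤ ε) : ContDiff ℝ ∞ (truncFun ε : E → E) := by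
  have h1 : ContDiff ℝ ∞ fun z : E => 1 + ε * ‖z‖ ^ 2 :=
    contDiff_const.add (contDiff_const.mul (contDiff_norm_sq ℝ))
  exact (h1.inv fun z => by positivity).smul contDiff_id

theorem fderiv_truncFun {ε : ℝ} (hε : 0 ≤ ε) (z w : E) :
    fderiv ℝ (truncFun ε) z w = truncDeriv ε z w := by
  have h1 : HasFDerivAt (fun z : E => 1 + ε * ‖z‖ ^ 2) (ε • (2 • innerSL ℝ z)) z :=
    ((hasStrictFDerivAt_norm_sq z).hasFDerivAt.const_mul ε).const_add 1
  have hne : 1 + ε * ‖z‖ ^ 2 ≠ 0 := by positivity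
  have h2 := ((hasDerivAt_inv hne).comp_hasFDerivAt z h1).smul (hasFDerivAt_id z)
  have h3 : HasFDerivAt (truncFun ε : E → E) _ z := h2
  rw [h3.fderiv, truncDeriv]
  simp only [add_apply, smul_apply,
    ContinuousLinearMap.id_apply, ContinuousLinearMap.smulRight_apply, id, innerSL_apply_apply,
    Function.comp_apply, smul_eq_mul, nsmul_eq_mul, Nat.cast_ofNat, inv_pow]
  rw [sub_eq_add_neg, ← neg_smul]
  congr 2
  ring

theorem norm_truncFun_le {ε : ℝ} (hε : 0 ≤ ε) (z : E) : ‖truncFun ε z‖ ≤ ‖z‖ := by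
  rw [truncFun, norm_smul, Real.norm_of_nonneg (by positivity)]
  exact mul_le_of_le_one_left (norm_nonneg _) (inv_le_one_of_one_le₀ (by
    have : 0 ≤ ε * ‖z‖ ^ 2 := by positivity
    linarith))

/-- The bound is uniform in `ε`: this lets the chain rule apply and later dominates the divergence
as `ε → 0`. -/
theorem norm_truncDeriv_le {ε : ℝ} (hε : 0 ≤ ε) (z w : E) : ‖truncDeriv ε z w‖ ≤ 3 * ‖w‖ := by
  have ht : 0 ≤ ε * ‖z‖ ^ 2 := by positivity
  set t := ε * ‖z‖ ^ 2 with htdef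
  have hχ0 : 0 ≤ (1 + t)⁻¹ := by positivity
  have hχ1 : (1 + t)⁻¹ ≤ 1 := inv_le_one_of_one_le₀ (by linarith)
  have hχt : (1 + t)⁻¹ * t ≤ 1 := by
    rw [inv_mul_le_iff₀ (by positivity)]; linarith
  have h1 : ‖(1 + t)⁻¹ • w‖ ≤ ‖w‖ := by
    rw [norm_smul, Real.norm_of_nonneg hχ0]
    exact mul_le_of_le_one_left (norm_nonneg _) hχ1
  have h2 : ‖((1 + t)⁻¹ ^ 2 * (2 * ε * ⟪z, w⟫)) • z‖ ≤ 2 * ‖w‖ := by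
    rw [norm_smul, Real.norm_eq_abs, abs_mul, abs_of_nonneg (sq_nonneg _), abs_mul,
      abs_of_nonneg (by positivity : 0 ≤ 2 * ε)]
    have h3 := abs_real_inner_le_norm z w
    calc (1 + t)⁻¹ ^ 2 * (2 * ε * |⟪z, w⟫|) * ‖z‖
        ≤ (1 + t)⁻¹ ^ 2 * (2 * ε * (‖z‖ * ‖w‖)) * ‖z‖ := by gcongr
      _ = (1 + t)⁻¹ * ((1 + t)⁻¹ * t) * (2 * ‖w‖) := by rw [htdef]; ring
      _ ≤ 1 * 1 * (2 * ‖w‖) := by gcongr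
      _ = 2 * ‖w‖ := by ring
  rw [truncDeriv]
  refine (norm_sub_le _ _).trans ?_
  linarith

theorem tendsto_truncFun (z : E) :
    Tendsto (fun n : ℕ => truncFun (1 / ((n : ℝ) + 1)) z) atTop (𝓝 z) := by
  have h1 : Continuous fun ε : ℝ => 1 + ε * ‖z‖ ^ 2 := by fun_prop
  have h2 := (((h1.tendsto 0).inv₀ (by simp)).comp
    (tendsto_one_div_add_atTop_nhds_zero_nat (𝕜 := ℝ))).smul_const z
  simpa [truncFun, Function.comp_def] using h2

theorem tendsto_truncDeriv (z w : E) :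
    Tendsto (fun n : ℕ => truncDeriv (1 / ((n : ℝ) + 1)) z w) atTop (𝓝 w) := by
  have h1 : Continuous fun ε : ℝ => 1 + ε * ‖z‖ ^ 2 := by fun_prop
  have h2 := (h1.tendsto 0).inv₀ (by simp)
  have h3 : Continuous fun ε : ℝ => 2 * ε * ⟪z, w⟫ := by fun_prop
  have h4 := ((h2.smul_const w).sub (((h2.pow 2).mul (h3.tendsto 0)).smul_const z)).comp
    (tendsto_one_div_add_atTop_nhds_zero_nat (𝕜 := ℝ))
  simpa [truncDeriv, Function.comp_def] using h4

/-- The bound that dominates the energy density of the truncated problem. -/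
theorem exists_truncFun_mul_le {p δ ε : ℝ} (hp : 1 < p) (hε : 0 < ε)
    (h : p ≤ 2 ∧ 0 < δ ∨ 2 ≤ p ∧ δ = 0) :
    ∃ C : ℝ, 0 ≤ C ∧ ∀ (z : E) (ζ : ℂ) (t m : ℝ), ‖z‖ ≤ m → ‖ζ‖ ≤ m → 0 ≤ t → t ≤ m →
      ‖truncFun ε z‖ * ((‖ζ‖ ^ 2 + δ) ^ ((p - 2) / 2) * t) ≤ C * m ^ p := by
  rcases h with ⟨hp2, hδ⟩ | ⟨hp2, rfl⟩
  · refine ⟨(1 + ε⁻¹) * δ ^ ((p - 2) / 2), by positivity, fun z ζ t m hz hζ ht htm => ?_⟩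
    have hm : 0 ≤ m := ht.trans htm
    have h1 : (‖ζ‖ ^ 2 + δ) ^ ((p - 2) / 2) ≤ δ ^ ((p - 2) / 2) :=
      Real.rpow_le_rpow_of_nonpos hδ (by nlinarith [sq_nonneg ‖ζ‖]) (by linarith)
    -- The truncation lowers the growth from `|z|` to `|z|^{p-1}`, because `|z|^{2-p} ≤ 1 + |z|² ≤
    -- (1 + ε⁻¹) (1 + ε |z|²)`. The product with a second gradient factor is then of order `m ^ p`.
    have h2 : ‖truncFun ε z‖ ≤ (1 + ε⁻¹) * m ^ (p - 1) := by
      rcases eq_or_ne z 0 with rfl | hz0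
      · simp only [truncFun, smul_zero, norm_zero]; positivity
      have hr : 0 < ‖z‖ := norm_pos_iff.2 hz0
      have h3 : ‖z‖ ^ (2 - p) ≤ 1 + ‖z‖ ^ 2 := by
        rcases le_total ‖z‖ 1 with h | h
        · have := Real.rpow_le_one hr.le h (by linarith : 0 ≤ 2 - p)
          nlinarith [sq_nonneg ‖z‖]
        · have := Real.rpow_le_rpow_of_exponent_le h (by linarith : 2 - p ≤ 2)
          rw [Real.rpow_two] at this
          linarith
      have h4 : 1 + ‖z‖ ^ 2 ≤ (1 + ε⁻¹) * (1 + ε * ‖z‖ ^ 2) := by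
        have e : (1 + ε⁻¹) * (1 + ε * ‖z‖ ^ 2) = 1 + ε * ‖z‖ ^ 2 + ε⁻¹ + ‖z‖ ^ 2 := by
          field_simp; ring
        have : 0 ≤ ε * ‖z‖ ^ 2 + ε⁻¹ := by positivity
        linarith
      rw [truncFun, norm_smul, Real.norm_of_nonneg (by positivity), inv_mul_le_iff₀ (by positivity)]
      calc ‖z‖ = ‖z‖ ^ (2 - p) * ‖z‖ ^ (p - 1) := by
            rw [← Real.rpow_add hr]; ring_nf; rw [Real.rpow_one]
        _ ≤ ((1 + ε⁻¹) * (1 + ε * ‖z‖ ^ 2)) * m ^ (p - 1) := by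
            gcongr
            exact h3.trans h4
        _ = _ := by ring
    calc _ ≤ ((1 + ε⁻¹) * m ^ (p - 1)) * (δ ^ ((p - 2) / 2) * m) := by gcongr
      _ = (1 + ε⁻¹) * δ ^ ((p - 2) / 2) * (m ^ (p - 1) * m) := by ring
      _ = _ := by
        congr 1
        rcases hm.eq_or_lt with h | h
        · rw [← h, mul_zero, Real.zero_rpow (by linarith)]
        · nth_rw 2 [← Real.rpow_one m]
          rw [← Real.rpow_add h]; ring_nf
  · refine ⟨1, zero_le_one, fun z ζ t m hz hζ ht htm => ?_⟩
    have hm : 0 ≤ m := ht.trans htm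
    rw [add_zero, norm_sq_rpow, mul_div_cancel₀ _ two_ne_zero, one_mul]
    calc _ ≤ m * (m ^ (p - 2) * m) := by
          gcongr
          exact (norm_truncFun_le hε.le z).trans hz
      _ = _ := by
        rcases hm.eq_or_lt with h | h
        · rw [← h, zero_mul, Real.zero_rpow (by linarith)]
        · nth_rw 1 [← Real.rpow_one m]
          nth_rw 3 [← Real.rpow_one m]
          rw [← Real.rpow_add h, ← Real.rpow_add h]; ring_nf

end Truncations

/-! ### Integration by parts against the regularized duality map. -/

noncomputable section EnergyIdentity

open Filter
open scoped Topology ContDiff ComplexConjugate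

variable {d : ℕ} {Ω : Opens (RSpace d)}

theorem setIntegral_smul_eq_integral_of_tsupport_subset {E : Type*} [NormedAddCommGroup E]
    [NormedSpace ℝ E] {φ : RSpace d → ℝ} (hs : tsupport φ ⊆ Ω) (f : RSpace d → E) :
    ∫ x, φ x • f x ∂(lebOn Ω) = ∫ x, φ x • f x :=
  setIntegral_eq_integral_of_forall_compl_eq_zero fun x hx => by
    rw [image_eq_zero_of_notMem_tsupport fun h => hx (hs h), zero_smul]

theorem isWeakPartial_iff {j : Fin d} {f g : RSpace d → ℂ} :
    IsWeakPartial Ω j f g ↔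
      HasWeakDerivOn volume (Ω : Set (RSpace d)) (EuclideanSpace.single j (1 : ℝ)) f g := by
  have key : ∀ φ : RSpace d → ℝ, tsupport φ ⊆ Ω →
      (∫ x, partialDeriv j φ x • f x ∂(lebOn Ω) = - ∫ x, φ x • g x ∂(lebOn Ω) ↔
      ∫ x, fderiv ℝ φ x (EuclideanSpace.single j (1 : ℝ)) • f x = -∫ x, φ x • g x) := by
    intro φ hs
    have h1 := setIntegral_smul_eq_integral_of_tsupport_subset (Ω := Ω)
      (φ := fun x => fderiv ℝ φ x (EuclideanSpace.single j (1 : ℝ)))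
      ((tsupport_fderiv_apply_subset ℝ _).trans hs) f
    rw [← h1, ← setIntegral_smul_eq_integral_of_tsupport_subset hs]
    rfl
  constructor
  · rintro ⟨h1, h2, h3⟩
    exact ⟨h1, h2, fun φ hφ hc hs => (key φ hs).1 (h3 ⟨φ, hφ, hc, hs⟩)⟩
  · rintro ⟨h1, h2, h3⟩
    exact ⟨h1, h2, fun φ => (key φ φ.tsupport_subset).2
      (h3 φ φ.contDiff φ.hasCompactSupport φ.tsupport_subset)⟩

section General

variable {V E : Type*} [NormedAddCommGroup V] [NormedSpace ℝ V] [FiniteDimensional ℝ V]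
  [MeasurableSpace V] [BorelSpace V] {μ : Measure V} [μ.IsAddHaarMeasure]
  [NormedAddCommGroup E] [NormedSpace ℝ E] [CompleteSpace E]

theorem HasWeakDerivOn.sum {ι : Type*} (s : Finset ι) {U : Set V} {v : V} {f g : ι → V → E}
    (h : ∀ i, HasWeakDerivOn μ U v (f i) (g i)) :
    HasWeakDerivOn μ U v (fun x => ∑ i ∈ s, f i x) (fun x => ∑ i ∈ s, g i x) := by
  classical
  induction s using Finset.induction_on with
  | empty =>
    have : LocallyIntegrableOn (fun _ : V => (0 : E)) U μ := locallyIntegrableOn_zero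
    simpa using (⟨this, this, by simp⟩ : HasWeakDerivOn μ U v (fun _ : V => (0 : E)) fun _ => 0)
  | insert a s ha ih =>
    simp only [Finset.sum_insert ha]
    refine ⟨(h a).locInt.add ih.locInt, (h a).locInt_deriv.add ih.locInt_deriv,
      fun φ hφ hc hs => ?_⟩
    have hφ' : Continuous fun x => fderiv ℝ φ x v :=
      (hφ.continuous_fderiv (by simp)).clm_apply continuous_const
    have hc' := hc.fderiv_apply ℝ v
    have hs' := (tsupport_fderiv_apply_subset ℝ (f := φ) v).trans hs
    simp only [smul_add]
    rw [integral_add (integrable_smul_of_locallyIntegrableOn (h a).locInt hφ' hc' hs')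
        (integrable_smul_of_locallyIntegrableOn ih.locInt hφ' hc' hs'),
      integral_add (integrable_smul_of_locallyIntegrableOn (h a).locInt_deriv hφ.continuous hc hs)
        (integrable_smul_of_locallyIntegrableOn ih.locInt_deriv hφ.continuous hc hs),
      (h a).integral_eq φ hφ hc hs, ih.integral_eq φ hφ hc hs, neg_add]

/-- Weak derivatives are tested with real functions; complex test functions follow from their real
and imaginary parts. -/
theorem HasWeakDerivOn.integral_mul_fderiv {U : Set V} {v : V} {f g : V → ℂ}
    (h : HasWeakDerivOn μ U v f g) {ψ : V → ℂ} (hψ : ContDiff ℝ ∞ ψ) (hc : HasCompactSupport ψ)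
    (hs : tsupport ψ ⊆ U) :
    ∫ x, f x * fderiv ℝ ψ x v ∂μ = -∫ x, g x * ψ x ∂μ := by
  have main : ∀ L : ℂ →L[ℝ] ℝ,
      ∫ x, L (fderiv ℝ ψ x v) • f x ∂μ = -∫ x, L (ψ x) • g x ∂μ ∧
      Integrable (fun x => L (fderiv ℝ ψ x v) • f x) μ ∧
      Integrable (fun x => L (ψ x) • g x) μ := by
    intro L
    have hφ : ContDiff ℝ ∞ fun x => L (ψ x) := L.contDiff.comp hψ
    have hc' : HasCompactSupport fun x => L (ψ x) := hc.comp_left (map_zero L)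
    have hs' : tsupport (fun x => L (ψ x)) ⊆ U :=
      (closure_mono fun x hx => by
        contrapose! hx
        simp [Function.notMem_support.1 hx]).trans hs
    have hd : ∀ x, fderiv ℝ (fun x => L (ψ x)) x v = L (fderiv ℝ ψ x v) := by
      intro x
      have h1 : HasFDerivAt (fun x => L (ψ x)) _ x :=
        L.hasFDerivAt.comp x (hψ.differentiable (by simp) x).hasFDerivAt
      rw [h1.fderiv]; rfl
    have hφ' : Continuous fun x => fderiv ℝ (fun x => L (ψ x)) x v :=
      (hφ.continuous_fderiv (by simp)).clm_apply continuous_const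
    have h1 := h.integral_eq _ hφ hc' hs'
    have h2 := integrable_smul_of_locallyIntegrableOn h.locInt hφ' (hc'.fderiv_apply ℝ v)
      ((tsupport_fderiv_apply_subset ℝ v).trans hs')
    have h3 := integrable_smul_of_locallyIntegrableOn h.locInt_deriv hφ.continuous hc' hs'
    simp only [hd] at h1 h2
    exact ⟨h1, h2, h3⟩
  obtain ⟨r1, r2, r3⟩ := main Complex.reCLM
  obtain ⟨i1, i2, i3⟩ := main Complex.imCLM
  have split : ∀ a b : ℂ, a * b = Complex.reCLM b • a + Complex.I * (Complex.imCLM b • a) := by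
    intro a b
    conv_lhs => rw [← Complex.re_add_im b]
    simp only [Complex.reCLM_apply, Complex.imCLM_apply, Complex.real_smul]
    ring
  have e1 : (fun x => f x * fderiv ℝ ψ x v) = _ := funext fun x => split (f x) (fderiv ℝ ψ x v)
  have e2 : (fun x => g x * ψ x) = _ := funext fun x => split (g x) (ψ x)
  rw [e1, e2, integral_add r2 (i2.const_mul _), integral_add r3 (i3.const_mul _), integral_const_mul,
    integral_const_mul, r1, i1]
  ring

end General

/-- An `L^p`-convergent sequence with summable distances converges almost everywhere and is
dominated by an `L^p` function. -/
theorem exists_dominating_of_eLpNorm_le {α F : Type*} [MeasurableSpace α] {ν : Measure α}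
    [NormedAddCommGroup F] {p : ℝ≥0∞} (hp : 1 ≤ p) {f : ℕ → α → F} {f' : α → F}
    (hf : ∀ n, AEStronglyMeasurable (f n) ν) (hf' : MemLp f' p ν)
    (h : ∀ n, eLpNorm (fun x => f' x - f n x) p ν ≤ 2⁻¹ ^ n) :
    (∀ᵐ x ∂ν, Tendsto (fun n => f n x) atTop (𝓝 (f' x))) ∧
      ∃ b : α → ℝ, MemLp b p ν ∧ ∀ᵐ x ∂ν, 0 ≤ b x ∧ ∀ n, ‖f n x‖ ≤ b x := by
  have : Fact (1 ≤ p) := ⟨hp⟩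
  have hm : ∀ n, MemLp (fun x => ‖f' x - f n x‖) p ν := fun n =>
    MemLp.norm ⟨hf'.aestronglyMeasurable.sub (hf n), (h n).trans_lt
      (ENNReal.pow_lt_top (by simp))⟩
  -- The series of the distances converges in `L^p` and almost everywhere. Its terms therefore tend
  -- to zero, and its sum plus `‖f'‖` is the majorant.
  let H : ℕ → Lp ℝ p ν := fun n => (hm n).toLp _
  have hH : ∑' n, ‖H n‖ₑ ≠ ⊤ := by
    refine ne_top_of_le_ne_top (b := ∑' n : ℕ, (2⁻¹ : ℝ≥0∞) ^ n) ?_ (ENNReal.tsum_le_tsum fun n => ?_)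
    · rw [ENNReal.tsum_geometric, ENNReal.one_sub_inv_two]; simp
    · rw [Lp.enorm_toLp, eLpNorm_norm]
      exact h n
  have hsum := Lp.hasSum_coeFn_tsum hH
  have hcoe : ∀ᵐ x ∂ν, ∀ n, H n x = ‖f' x - f n x‖ := ae_all_iff.2 fun n => (hm n).coeFn_toLp
  constructor
  · filter_upwards [hsum, hcoe] with x h1 h2
    simp only [h2] at h1
    refine tendsto_iff_norm_sub_tendsto_zero.2 ?_
    simpa only [norm_sub_rev] using h1.summable.tendsto_atTop_zero
  · refine ⟨fun x => ‖f' x‖ + (∑' n, H n : Lp ℝ p ν) x, hf'.norm.add (Lp.memLp _), ?_⟩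
    filter_upwards [hsum, hcoe] with x h1 h2
    simp only [h2] at h1
    have h3 : ∀ n, ‖f n x‖ ≤ ‖f' x‖ + (∑' n, H n : Lp ℝ p ν) x := by
      intro n
      have h4 := le_hasSum h1 n fun m _ => norm_nonneg _
      have h5 := norm_sub_norm_le (f n x) (f' x)
      rw [norm_sub_rev] at h5
      linarith
    exact ⟨(norm_nonneg _).trans (h3 0), h3⟩

theorem tendsto_integral_mul_of_compactSupport {ι : Type*} {l : Filter ι} [l.IsCountablyGenerated]
    {Y : RSpace d → ℂ} (hY : LocallyIntegrableOn Y (Ω : Set (RSpace d)) volume)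
    {K : Set (RSpace d)} (hK : IsCompact K) (hKΩ : K ⊆ Ω) {v : ι → RSpace d → ℂ}
    {v' : RSpace d → ℂ} (hv : ∀ i, Continuous (v i)) {B : ℝ}
    (hB : ∀ i x, ‖v i x‖ ≤ B) (h0 : ∀ i, ∀ x ∉ K, v i x = 0)
    (hlim : ∀ x, Tendsto (fun i => v i x) l (𝓝 (v' x))) :
    Tendsto (fun i => ∫ x, Y x * v i x ∂(lebOn Ω)) l (𝓝 (∫ x, Y x * v' x ∂(lebOn Ω))) := by
  have hYK : IntegrableOn Y K (lebOn Ω) := by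
    rw [IntegrableOn, Measure.restrict_restrict hK.measurableSet,
      Set.inter_eq_left.2 hKΩ]
    exact hY.integrableOn_compact_subset hKΩ hK
  have hbound : Integrable (K.indicator fun x => ‖Y x‖ * B) (lebOn Ω) :=
    (integrable_indicator_iff hK.measurableSet).2 (hYK.norm.mul_const B)
  have hYm : AEStronglyMeasurable Y (lebOn Ω) := hY.aestronglyMeasurable
  refine tendsto_integral_filter_of_dominated_convergence _
    (Eventually.of_forall fun i => hYm.mul (hv i).aestronglyMeasurable)
    (Eventually.of_forall fun i => Eventually.of_forall fun x => ?_) hbound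
    (Eventually.of_forall fun x => tendsto_const_nhds.mul (hlim x))
  by_cases hx : x ∈ K
  · rw [Set.indicator_of_mem hx, norm_mul]
    exact mul_le_mul_of_nonneg_left (hB i x) (norm_nonneg _)
  · rw [h0 i x hx]; simp [hx]

theorem continuous_partialDeriv (φ : 𝓓(Ω, ℂ)) (l : Fin d) : Continuous (partialDeriv l φ) :=
  (φ.contDiff.continuous_fderiv (by simp)).clm_apply continuous_const

theorem partialDeriv_eq_zero (φ : 𝓓(Ω, ℂ)) (l : Fin d) {x : RSpace d} (hx : x ∉ tsupport φ) :
    partialDeriv l φ x = 0 := by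
  have h := tsupport_fderiv_subset ℝ (f := (φ : RSpace d → ℂ))
  have : fderiv ℝ φ x = 0 := by
    by_contra h1
    exact hx (h (subset_tsupport _ h1))
  rw [partialDeriv, this]; rfl

theorem continuous_regFun_comp {p δ : ℝ} (h : 0 < δ ∨ 2 ≤ p) {φ : RSpace d → ℂ}
    (hφ : Continuous φ) : Continuous fun x => regFun p δ (φ x) := by
  refine continuous_iff_continuousAt.2 fun x => tendsto_regFun tendsto_const_nhds (hφ.tendsto x) ?_
  exact h.imp_left fun h => by positivity

theorem continuous_regDeriv_comp {p δ : ℝ} (hδ : 0 ≤ δ) (h : 0 < δ ∨ 2 ≤ p) {φ ψ : RSpace d → ℂ}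
    (hφ : Continuous φ) (hψ : Continuous ψ) : Continuous fun x => regDeriv p δ (φ x) (ψ x) :=
  continuous_iff_continuousAt.2 fun x => tendsto_regDeriv (fun _ => hδ) tendsto_const_nhds
    (hφ.tendsto x) (hψ.tendsto x) hδ h

theorem integral_mul_regFun_smooth {p δ : ℝ} (hδ : 0 < δ) {l : Fin d} {H X : RSpace d → ℂ}
    (hH : IsWeakPartial Ω l H X) (φ : 𝓓(Ω, ℂ)) :
    ∫ x, H x * conj (regDeriv p δ (φ x) (partialDeriv l φ x)) ∂(lebOn Ω) =
      -∫ x, X x * conj (regFun p δ (φ x)) ∂(lebOn Ω) := by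
  have hreg := contDiff_regFun p hδ
  set ψ : RSpace d → ℂ := fun x => conj (regFun p δ (φ x)) with hψ
  have hψs : ContDiff ℝ ∞ ψ := Complex.conjCLE.contDiff.comp (hreg.comp φ.contDiff)
  have h0 : ∀ x, φ x = 0 → ψ x = 0 := fun x hx => by simp [hψ, hx, regFun_zero_right]
  have hsub : tsupport ψ ⊆ tsupport φ := closure_mono fun x hx => by
    contrapose! hx
    simp [h0 x (Function.notMem_support.1 hx)]
  have hc : HasCompactSupport ψ := φ.hasCompactSupport.of_isClosed_subset (isClosed_tsupport ψ) hsub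
  have hs : tsupport ψ ⊆ Ω := hsub.trans φ.tsupport_subset
  have hd : ∀ x, fderiv ℝ ψ x (EuclideanSpace.single l (1 : ℝ)) =
      conj (regDeriv p δ (φ x) (partialDeriv l φ x)) := by
    intro x
    have h1 := (hreg.differentiable (by simp) (φ x)).hasFDerivAt.comp x
      (φ.contDiff.differentiable (by simp) x).hasFDerivAt
    have h2 : HasFDerivAt ψ _ x := Complex.conjCLE.hasFDerivAt.comp x h1
    rw [h2.fderiv, ← fderiv_regFun p hδ]
    rfl
  have h := (isWeakPartial_iff.1 hH).integral_mul_fderiv hψs hc hs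
  simp only [hd] at h
  rw [setIntegral_eq_integral_of_forall_compl_eq_zero, h,
    setIntegral_eq_integral_of_forall_compl_eq_zero]
  · intro x hx
    change X x * ψ x = 0
    rw [image_eq_zero_of_notMem_tsupport fun h => hx (hs h), mul_zero]
  · intro x hx
    rw [partialDeriv_eq_zero φ l fun h => hx (φ.tsupport_subset h)]
    simp [regDeriv]

/-- For `p ≥ 2` and `δ = 0` the duality map need not be smooth at zero; the identity is the limit of
those with `δ = 1/(n+1)`, everything being bounded on the support of `φ`. -/
theorem integral_mul_regFun_testFunction {p δ : ℝ} (h : p ≤ 2 ∧ 0 < δ ∨ 2 ≤ p ∧ δ = 0) {l : Fin d}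
    {H X : RSpace d → ℂ} (hH : IsWeakPartial Ω l H X) (φ : 𝓓(Ω, ℂ)) :
    ∫ x, H x * conj (regDeriv p δ (φ x) (partialDeriv l φ x)) ∂(lebOn Ω) =
      -∫ x, X x * conj (regFun p δ (φ x)) ∂(lebOn Ω) := by
  rcases h with ⟨-, hδ⟩ | ⟨hp, rfl⟩
  · exact integral_mul_regFun_smooth hδ hH φ
  have hφ := φ.continuous
  have hφ' := continuous_partialDeriv φ l
  have hc : HasCompactSupport (partialDeriv l φ) :=
    φ.hasCompactSupport.fderiv_apply ℝ _
  obtain ⟨B, hB⟩ := hφ.bounded_above_of_compact_support φ.hasCompactSupport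
  obtain ⟨B', hB'⟩ := hφ'.bounded_above_of_compact_support hc
  have hB0 : 0 ≤ B := (norm_nonneg _).trans (hB 0)
  let δ' : ℕ → ℝ := fun n => 1 / ((n : ℝ) + 1)
  have hδ0 : ∀ n, 0 < δ' n := fun n => by positivity
  have hδ1 : ∀ n, δ' n ≤ 1 := fun n => by
    rw [div_le_one (by positivity)]; linarith [n.cast_nonneg (α := ℝ)]
  have hδt : Tendsto δ' atTop (𝓝 0) := tendsto_one_div_add_atTop_nhds_zero_nat
  have lim1 := tendsto_integral_mul_of_compactSupport (l := atTop) hH.1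
    φ.hasCompactSupport φ.tsupport_subset
    (v := fun n x => conj (regDeriv p (δ' n) (φ x) (partialDeriv l φ x)))
    (v' := fun x => conj (regDeriv p 0 (φ x) (partialDeriv l φ x)))
    (B := (1 + |p - 2|) * (B ^ 2 + 1) ^ ((p - 2) / 2) * B')
    (fun n => Complex.continuous_conj.comp
      (continuous_regDeriv_comp (hδ0 n).le (Or.inl (hδ0 n)) hφ hφ'))
    (fun n x => by
      rw [Complex.norm_conj]
      refine (norm_regDeriv_le p (hδ0 n).le _ _).trans ?_
      gcongr
      · exact hB x
      · exact hδ1 n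
      · exact hB' x)
    (fun n x hx => by rw [partialDeriv_eq_zero φ l hx]; simp [regDeriv])
    (fun x => (Complex.continuous_conj.tendsto _).comp
      (tendsto_regDeriv (fun n => (hδ0 n).le) hδt tendsto_const_nhds tendsto_const_nhds le_rfl
        (Or.inr hp)))
  have lim2 := tendsto_integral_mul_of_compactSupport (l := atTop) hH.2.1
    φ.hasCompactSupport φ.tsupport_subset
    (v := fun n x => conj (regFun p (δ' n) (φ x)))
    (v' := fun x => conj (regFun p 0 (φ x)))
    (B := (B ^ 2 + 1) ^ ((p - 2) / 2) * B)
    (fun n => Complex.continuous_conj.comp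
      (continuous_regFun_comp (Or.inl (hδ0 n)) hφ))
    (fun n x => by
      rw [Complex.norm_conj, norm_regFun p _ (hδ0 n).le]
      gcongr
      · exact hB x
      · exact hδ1 n
      · exact hB x)
    (fun n x hx => by
      rw [image_eq_zero_of_notMem_tsupport hx, regFun_zero_right, map_zero])
    (fun x => (Complex.continuous_conj.tendsto _).comp
      (tendsto_regFun hδt tendsto_const_nhds (Or.inr hp)))
  exact tendsto_nhds_unique lim1
    (lim2.neg.congr fun n => (integral_mul_regFun_smooth (hδ0 n) hH φ).symm)

theorem mul_rpow_sub_one_le {p a m : ℝ} (hp : 1 < p) (ha : a ≤ m) (hm : 0 ≤ m) :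
    a * m ^ (p - 1) ≤ m ^ p := by
  rcases hm.eq_or_lt with h | h
  · rw [← h, Real.zero_rpow (by linarith), Real.zero_rpow (by linarith), mul_zero]
  · calc a * m ^ (p - 1) ≤ m * m ^ (p - 1) :=
        mul_le_mul_of_nonneg_right ha (Real.rpow_nonneg hm _)
      _ = m ^ p := by
        nth_rw 1 [← Real.rpow_one m]
        rw [← Real.rpow_add h]; ring_nf

theorem integrable_rpow_of_memLp {p : ℝ} (hp : 1 < p) {m : RSpace d → ℝ}
    (hm : MemLp m (ENNReal.ofReal p) (lebOn Ω)) (h0 : ∀ᵐ x ∂(lebOn Ω), 0 ≤ m x) :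
    Integrable (fun x => m x ^ p) (lebOn Ω) := by
  have h := hm.integrable_norm_rpow (by simp; linarith) ENNReal.ofReal_ne_top
  rw [ENNReal.toReal_ofReal (by linarith)] at h
  refine h.congr ?_
  filter_upwards [h0] with x hx
  rw [Real.norm_of_nonneg hx]

/-- Integration by parts against `regFun p δ u` for `u ∈ W^{1,p}_0`. -/
theorem integral_mul_regFun {E : Type*} [NormedAddCommGroup E] [InnerProductSpace ℝ E]
    {p δ ε M : ℝ} (hp : 1 < p) (hδ : p ≤ 2 ∧ 0 < δ ∨ 2 ≤ p ∧ δ = 0) (hε : 0 < ε) (hM : 0 ≤ M)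
    {u : RSpace d → ℂ} (hu : MemW10 Ω (ENNReal.ofReal p) u)
    (huL : MemLp u (ENNReal.ofReal p) (lebOn Ω)) {l : Fin d} {g : RSpace d → ℂ}
    (hg : IsWeakPartial Ω l u g) (hgL : MemLp g (ENNReal.ofReal p) (lebOn Ω))
    {H X : RSpace d → ℂ} (hH : IsWeakPartial Ω l H X) (hX : MemLp X (ENNReal.ofReal p) (lebOn Ω))
    {z : RSpace d → E} (hz : MemLp z (ENNReal.ofReal p) (lebOn Ω))
    (hHz : ∀ᵐ x ∂(lebOn Ω), ‖H x‖ ≤ M * ‖truncFun ε (z x)‖) :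
    Integrable (fun x => H x * conj (regDeriv p δ (u x) (g x))) (lebOn Ω) ∧
    Integrable (fun x => X x * conj (regFun p δ (u x))) (lebOn Ω) ∧
    ∫ x, H x * conj (regDeriv p δ (u x) (g x)) ∂(lebOn Ω) =
      -∫ x, X x * conj (regFun p δ (u x)) ∂(lebOn Ω) := by
  have hp1 : 1 ≤ ENNReal.ofReal p := by simpa using ENNReal.ofReal_le_ofReal hp.le
  have hδ0 : 0 ≤ δ := by rcases hδ with h | h <;> linarith [h.2]
  have hδ2 : 0 < δ ∨ 2 ≤ p := hδ.imp And.right And.left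
  choose φ hφ1 hφ2 using fun n : ℕ => hu.2 (2⁻¹ ^ n) (ENNReal.pow_pos (by simp) n)
  obtain ⟨lim1, b₁, hb₁, hb₁'⟩ := exists_dominating_of_eLpNorm_le hp1
    (fun n => (φ n).continuous.aestronglyMeasurable) huL hφ1
  obtain ⟨lim2, b₂, hb₂, hb₂'⟩ := exists_dominating_of_eLpNorm_le hp1
    (fun n => (continuous_partialDeriv (φ n) l).aestronglyMeasurable) hgL
    (fun n => hφ2 n l g hg)
  -- A single `L^p` majorant of all factors; both integrands are then bounded by multiples of `m ^
  -- p`, uniformly in the test functions.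
  set m : RSpace d → ℝ := fun x => ‖X x‖ + ‖z x‖ + b₁ x + b₂ x with hm
  have hmL : MemLp m (ENNReal.ofReal p) (lebOn Ω) := ((hX.norm.add hz.norm).add hb₁).add hb₂
  have hbounds : ∀ᵐ x ∂(lebOn Ω), 0 ≤ m x ∧ ‖X x‖ ≤ m x ∧ ‖z x‖ ≤ m x ∧
      (∀ n, ‖φ n x‖ ≤ m x) ∧ ∀ n, ‖partialDeriv l (φ n) x‖ ≤ m x := by
    filter_upwards [hb₁', hb₂'] with x h1 h2
    have hx := norm_nonneg (X x)
    have hz := norm_nonneg (z x)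
    simp only [hm]
    exact ⟨by linarith, by linarith, by linarith, fun n => by linarith [h1.2 n],
      fun n => by linarith [h2.2 n]⟩
  have hmp := integrable_rpow_of_memLp hp hmL (hbounds.mono fun x hx => hx.1)
  obtain ⟨C, hC0, hC⟩ := exists_truncFun_mul_le (E := E) hp hε hδ
  have hHm : AEStronglyMeasurable H (lebOn Ω) := hH.1.aestronglyMeasurable
  have bd1 : ∀ n, ∀ᵐ x ∂(lebOn Ω),
      ‖H x * conj (regDeriv p δ (φ n x) (partialDeriv l (φ n) x))‖ ≤
        M * (1 + |p - 2|) * C * m x ^ p := by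
    intro n
    filter_upwards [hbounds, hHz] with x hx hHx
    rw [norm_mul, Complex.norm_conj]
    have h1 := hC (z x) (φ n x) ‖partialDeriv l (φ n) x‖ (m x) hx.2.2.1 (hx.2.2.2.1 n)
      (norm_nonneg _) (hx.2.2.2.2 n)
    calc _ ≤ M * ‖truncFun ε (z x)‖ * ((1 + |p - 2|) * (‖φ n x‖ ^ 2 + δ) ^ ((p - 2) / 2)
          * ‖partialDeriv l (φ n) x‖) :=
          mul_le_mul hHx (norm_regDeriv_le p hδ0 _ _) (norm_nonneg _) (by positivity)
      _ = M * (1 + |p - 2|) * (‖truncFun ε (z x)‖ * ((‖φ n x‖ ^ 2 + δ) ^ ((p - 2) / 2)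
          * ‖partialDeriv l (φ n) x‖)) := by ring
      _ ≤ M * (1 + |p - 2|) * (C * m x ^ p) := by gcongr
      _ = _ := by ring
  have bd2 : ∀ n, ∀ᵐ x ∂(lebOn Ω), ‖X x * conj (regFun p δ (φ n x))‖ ≤ m x ^ p := by
    intro n
    filter_upwards [hbounds] with x hx
    rw [norm_mul, Complex.norm_conj]
    refine le_trans ?_ (mul_rpow_sub_one_le hp hx.2.1 hx.1)
    gcongr
    refine (norm_regFun_le hp hδ _).trans ?_
    exact Real.rpow_le_rpow (norm_nonneg _) (hx.2.2.2.1 n) (by linarith)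
  have ms1 : ∀ n, AEStronglyMeasurable
      (fun x => H x * conj (regDeriv p δ (φ n x) (partialDeriv l (φ n) x))) (lebOn Ω) := fun n =>
    hHm.mul (Complex.continuous_conj.comp (continuous_regDeriv_comp hδ0 hδ2 (φ n).continuous
      (continuous_partialDeriv (φ n) l))).aestronglyMeasurable
  have ms2 : ∀ n, AEStronglyMeasurable
      (fun x => X x * conj (regFun p δ (φ n x))) (lebOn Ω) := fun n =>
    hX.aestronglyMeasurable.mul (Complex.continuous_conj.comp (continuous_regFun_comp hδ2
      (φ n).continuous)).aestronglyMeasurable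
  have l1 : ∀ᵐ x ∂(lebOn Ω), Tendsto
      (fun n => H x * conj (regDeriv p δ (φ n x) (partialDeriv l (φ n) x))) atTop
      (𝓝 (H x * conj (regDeriv p δ (u x) (g x)))) := by
    filter_upwards [lim1, lim2] with x h1 h2
    exact tendsto_const_nhds.mul ((Complex.continuous_conj.tendsto _).comp
      (tendsto_regDeriv (fun _ => hδ0) tendsto_const_nhds h1 h2 hδ0 hδ2))
  have l2 : ∀ᵐ x ∂(lebOn Ω), Tendsto (fun n => X x * conj (regFun p δ (φ n x))) atTop
      (𝓝 (X x * conj (regFun p δ (u x)))) := by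
    filter_upwards [lim1] with x h1
    exact tendsto_const_nhds.mul ((Complex.continuous_conj.tendsto _).comp
      (tendsto_regFun tendsto_const_nhds h1 (hδ2.imp_left fun h => by positivity)))
  have lim_int : ∀ {F : ℕ → RSpace d → ℂ} {F' : RSpace d → ℂ} {B : RSpace d → ℝ},
      Integrable B (lebOn Ω) → (∀ n, AEStronglyMeasurable (F n) (lebOn Ω)) →
      (∀ n, ∀ᵐ x ∂(lebOn Ω), ‖F n x‖ ≤ B x) →
      (∀ᵐ x ∂(lebOn Ω), Tendsto (fun n => F n x) atTop (𝓝 (F' x))) →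
      Integrable F' (lebOn Ω) := by
    intro F F' B hB hF hFB hl
    refine hB.mono' (aestronglyMeasurable_of_tendsto_ae atTop hF hl) ?_
    filter_upwards [ae_all_iff.2 hFB, hl] with x h1 h2
    exact le_of_tendsto h2.norm (Eventually.of_forall h1)
  have hmp' := hmp.const_mul (M * (1 + |p - 2|) * C)
  refine ⟨lim_int hmp' ms1 bd1 l1, lim_int hmp ms2 bd2 l2, ?_⟩
  have t1 := tendsto_integral_of_dominated_convergence _ ms1 hmp' bd1 l1
  have t2 := tendsto_integral_of_dominated_convergence _ ms2 hmp bd2 l2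
  exact tendsto_nhds_unique t1
    (t2.neg.congr fun n => (integral_mul_regFun_testFunction hδ hH (φ n)).symm)

end EnergyIdentity

/-! ### From the pointwise estimate to the operator. -/

noncomputable section SectorialEstimates

open Filter
open scoped Topology ContDiff ComplexConjugate

variable {d : ℕ} {Ω : Opens (RSpace d)}

theorem exists_bound_of_memLp_top {f : RSpace d → ℂ} (hf : MemLp f ⊤ (lebOn Ω)) :
    ∃ M : ℝ, 0 ≤ M ∧ ∀ᵐ x ∂(lebOn Ω), ‖f x‖ ≤ M := by
  refine ⟨(eLpNorm f ⊤ (lebOn Ω)).toReal, ENNReal.toReal_nonneg, ?_⟩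
  filter_upwards [ae_le_eLpNormEssSup (f := f) (μ := lebOn Ω)] with x hx
  rw [← toReal_enorm]
  exact ENNReal.toReal_mono hf.2.ne (by rwa [eLpNorm_exponent_top])

theorem IsWeakPartial.congr_left {j : Fin d} {f f' g : RSpace d → ℂ} (h : IsWeakPartial Ω j f g)
    (hf : ∀ᵐ x ∂(lebOn Ω), f x = f' x) : IsWeakPartial Ω j f' g := by
  refine ⟨?_, h.2.1, fun φ => ?_⟩
  · rw [locallyIntegrableOn_iff Ω.isOpen.isLocallyClosed]
    intro K hKΩ hK
    refine (h.1.integrableOn_compact_subset hKΩ hK).congr ?_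
    exact ae_restrict_of_ae_restrict_of_subset hKΩ hf
  · rw [← h.2.2 φ]
    refine integral_congr_ae ?_
    filter_upwards [hf] with x hx
    rw [hx]

theorem IsWeakPartial.ae_eq {j : Fin d} {f g g' : RSpace d → ℂ} (h : IsWeakPartial Ω j f g)
    (h' : IsWeakPartial Ω j f g') : ∀ᵐ x ∂(lebOn Ω), g x = g' x :=
  (isWeakPartial_iff.1 h).ae_eq Ω.isOpen (isWeakPartial_iff.1 h')

theorem IsWeakPartial.mul_of_bounded {j : Fin d} {a a' b b' : RSpace d → ℂ} {M : ℝ}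
    (ha : IsWeakPartial Ω j a a') (hb : IsWeakPartial Ω j b b')
    (hM : ∀ᵐ x ∂(lebOn Ω), ‖a x‖ ≤ M) (hM' : ∀ᵐ x ∂(lebOn Ω), ‖a' x‖ ≤ M) (hM0 : 0 ≤ M) :
    IsWeakPartial Ω j (fun x => a x * b x) (fun x => a' x * b x + a x * b' x) :=
  isWeakPartial_iff.2 ((isWeakPartial_iff.1 ha).mul_of_bounded Ω.isOpen (isWeakPartial_iff.1 hb)
    hM hM' hM0)

theorem abs_im_integral_le {α : Type*} [MeasurableSpace α] {ν : Measure α} {F : α → ℂ} {K : ℝ}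
    (hF : Integrable F ν) (h : ∀ᵐ x ∂ν, |(F x).im| ≤ K * (F x).re) :
    |(∫ x, F x ∂ν).im| ≤ K * (∫ x, F x ∂ν).re := by
  have h1 : (∫ x, F x ∂ν).im = ∫ x, (F x).im ∂ν := (integral_im (𝕜 := ℂ) hF).symm
  have h2 : (∫ x, F x ∂ν).re = ∫ x, (F x).re ∂ν := (integral_re (𝕜 := ℂ) hF).symm
  rw [h1, h2, ← integral_const_mul]
  refine (abs_integral_le_integral_abs).trans (integral_mono_ae hF.im.abs (hF.re.const_mul K) h)

/-- The vector in `ℂ^d` with given components, as a continuous linear map in each component. -/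
def componentCLM (d : ℕ) (k : Fin d) : ℂ →L[ℝ] EuclideanSpace ℂ (Fin d) :=
  ((PiLp.continuousLinearEquiv 2 ℝ (fun _ : Fin d => ℂ)).symm :
    (Fin d → ℂ) →L[ℝ] EuclideanSpace ℂ (Fin d)).comp
      (ContinuousLinearMap.single ℝ (fun _ : Fin d => ℂ) k)

theorem sum_componentCLM_apply (a : Fin d → ℂ) (k : Fin d) :
    (∑ i, componentCLM d i (a i)) k = a k := by
  have h : ∑ i, componentCLM d i (a i) = (PiLp.continuousLinearEquiv 2 ℝ (fun _ : Fin d => ℂ)).symm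
      (∑ i, Pi.single i (a i)) := by
    rw [map_sum]; rfl
  rw [h, Finset.univ_sum_single]
  rfl

/-- The weak derivatives of the truncated flux: the product and the chain rule applied to
`∑_k c_{kl} (T_ε g)_k`, where `T_ε` is `truncFun ε`. -/
theorem isWeakPartial_truncated_flux {ε M : ℝ} (hε : 0 < ε) (hM : 0 ≤ M)
    {c c' : Fin d → Fin d → RSpace d → ℂ} {g : Fin d → RSpace d → ℂ}
    {gg : Fin d → Fin d → RSpace d → ℂ}
    (hc : ∀ k l, IsWeakPartial Ω l (c k l) (c' k l))
    (hcM : ∀ k l, ∀ᵐ x ∂(lebOn Ω), ‖c k l x‖ ≤ M)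
    (hcM' : ∀ k l, ∀ᵐ x ∂(lebOn Ω), ‖c' k l x‖ ≤ M)
    (hg : ∀ k l, IsWeakPartial Ω l (g k) (gg k l)) (l : Fin d) :
    IsWeakPartial Ω l
      (fun x => ∑ k, c k l x * truncFun ε (∑ i, componentCLM d i (g i x)) k)
      (fun x => ∑ k, (c' k l x * truncFun ε (∑ i, componentCLM d i (g i x)) k +
        c k l x * truncDeriv ε (∑ i, componentCLM d i (g i x))
          (∑ i, componentCLM d i (gg i l x)) k)) := by
  rw [isWeakPartial_iff]
  refine HasWeakDerivOn.sum Finset.univ fun k => ?_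
  rw [← isWeakPartial_iff]
  refine (hc k l).mul_of_bounded ?_ (hcM k l) (hcM' k l) hM
  rw [isWeakPartial_iff]
  have h1 : HasWeakDerivOn volume (Ω : Set (RSpace d)) (EuclideanSpace.single l (1 : ℝ))
      (fun x => ∑ i, componentCLM d i (g i x)) (fun x => ∑ i, componentCLM d i (gg i l x)) := by
    refine HasWeakDerivOn.sum Finset.univ fun i => ?_
    have := (isWeakPartial_iff.1 (hg i l)).comp_contDiff Ω.isOpen (componentCLM d i).contDiff
      (L := ‖componentCLM d i‖) fun z => by rw [ContinuousLinearMap.fderiv]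
    simpa only [ContinuousLinearMap.fderiv] using this
  have h2 := h1.comp_contDiff Ω.isOpen (Ψ := truncFun ε) (L := 3)
    ((contDiff_truncFun hε.le).of_le (by exact_mod_cast le_top)) fun z =>
      ContinuousLinearMap.opNorm_le_bound _ (by norm_num) fun w => by
        rw [fderiv_truncFun hε.le]; exact norm_truncDeriv_le hε.le z w
  simp only [fderiv_truncFun hε.le] at h2
  let P : EuclideanSpace ℂ (Fin d) →L[ℝ] ℂ := PiLp.proj 2 (fun _ : Fin d => ℂ) k
  have h3 := h2.comp_contDiff Ω.isOpen P.contDiff (L := ‖P‖) fun z => by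
    rw [ContinuousLinearMap.fderiv]
  simp only [ContinuousLinearMap.fderiv] at h3
  exact h3

theorem norm_sum_mul_le {M : ℝ} (a b : Fin d → ℂ) {t : ℝ} (hM : 0 ≤ M) (ha : ∀ k, ‖a k‖ ≤ M)
    (hb : ∀ k, ‖b k‖ ≤ t) : ‖∑ k, a k * b k‖ ≤ d * M * t := by
  refine (norm_sum_le _ _).trans ?_
  calc ∑ k, ‖a k * b k‖ ≤ ∑ _k : Fin d, M * t := Finset.sum_le_sum fun k _ => by
        rw [norm_mul]
        exact mul_le_mul (ha k) (hb k) (norm_nonneg _) hM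
    _ = d * M * t := by simp [mul_assoc]

theorem memLp_sum_componentCLM {q : ℝ≥0∞} {g : Fin d → RSpace d → ℂ}
    (hg : ∀ k, MemLp (g k) q (lebOn Ω)) :
    MemLp (fun x => ∑ i, componentCLM d i (g i x)) q (lebOn Ω) :=
  memLp_finsetSum _ fun i _ => (componentCLM d i).comp_memLp' (hg i)

/-- The sectorial estimate for the divergence-form expression with the regularized duality map. -/
theorem sectorial_regFun {p δ K M : ℝ} (hp : 1 < p) (hδ : p ≤ 2 ∧ 0 < δ ∨ 2 ≤ p ∧ δ = 0)
    (hM : 0 ≤ M) {c c' : Fin d → Fin d → RSpace d → ℂ} {u : RSpace d → ℂ}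
    {g : Fin d → RSpace d → ℂ} {gg : Fin d → Fin d → RSpace d → ℂ}
    (hc : ∀ k l, IsWeakPartial Ω l (c k l) (c' k l))
    (hcM : ∀ k l, ∀ᵐ x ∂(lebOn Ω), ‖c k l x‖ ≤ M)
    (hcM' : ∀ k l, ∀ᵐ x ∂(lebOn Ω), ‖c' k l x‖ ≤ M)
    (hu : MemW10 Ω (ENNReal.ofReal p) u) (huL : MemLp u (ENNReal.ofReal p) (lebOn Ω))
    (hg : ∀ k, IsWeakPartial Ω k u (g k)) (hgL : ∀ k, MemLp (g k) (ENNReal.ofReal p) (lebOn Ω))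
    (hgg : ∀ k l, IsWeakPartial Ω l (g k) (gg k l))
    (hggL : ∀ k l, MemLp (gg k l) (ENNReal.ofReal p) (lebOn Ω))
    (hpt : ∀ᵐ x ∂(lebOn Ω), ∀ (z : ℂ) (w : Fin d → ℂ),
      |(gradForm (Matrix.of fun k l => c k l x) w fun l => regDeriv p δ z (w l)).im| ≤
        K * (gradForm (Matrix.of fun k l => c k l x) w fun l => regDeriv p δ z (w l)).re)
    {f : RSpace d → ℂ}
    (hf : ∀ᵐ x ∂(lebOn Ω), f x = -∑ k, ∑ l, (c' k l x * g k x + c k l x * gg k l x)) :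
    |(∫ x, f x * conj (regFun p δ (u x)) ∂(lebOn Ω)).im| ≤
      K * (∫ x, f x * conj (regFun p δ (u x)) ∂(lebOn Ω)).re := by
  have hδ0 : 0 ≤ δ := by rcases hδ with h | h <;> linarith [h.2]
  have hδ2 : 0 < δ ∨ 2 ≤ p := hδ.imp And.right And.left
  set z : RSpace d → EuclideanSpace ℂ (Fin d) := fun x => ∑ i, componentCLM d i (g i x) with hz
  set zz : Fin d → RSpace d → EuclideanSpace ℂ (Fin d) :=
    fun l x => ∑ i, componentCLM d i (gg i l x) with hzz
  have hzk : ∀ x k, z x k = g k x := fun x k => sum_componentCLM_apply _ k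
  have hzzk : ∀ l x k, zz l x k = gg k l x := fun l x k => sum_componentCLM_apply _ k
  have hzL : MemLp z (ENNReal.ofReal p) (lebOn Ω) := memLp_sum_componentCLM hgL
  have hzzL : ∀ l, MemLp (zz l) (ENNReal.ofReal p) (lebOn Ω) := fun l =>
    memLp_sum_componentCLM fun k => hggL k l
  have hcM2 : ∀ᵐ x ∂(lebOn Ω), ∀ k l, ‖c k l x‖ ≤ M ∧ ‖c' k l x‖ ≤ M :=
    ae_all_iff.2 fun k => ae_all_iff.2 fun l => (hcM k l).and (hcM' k l)
  -- `H` is the truncated flux and `X` the list of its partial derivatives, so that `-∑ l, X ε l`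
  -- approximates `f`.
  let H : ℝ → Fin d → RSpace d → ℂ := fun ε l x => ∑ k, c k l x * truncFun ε (z x) k
  let X : ℝ → Fin d → RSpace d → ℂ := fun ε l x =>
    ∑ k, (c' k l x * truncFun ε (z x) k + c k l x * truncDeriv ε (z x) (zz l x) k)
  have hHX : ∀ ε, 0 < ε → ∀ l, IsWeakPartial Ω l (H ε l) (X ε l) := fun ε hε l =>
    isWeakPartial_truncated_flux hε hM hc hcM hcM' hgg l
  have hHb : ∀ ε, ∀ᵐ x ∂(lebOn Ω), ∀ l, ‖H ε l x‖ ≤ d * M * ‖truncFun ε (z x)‖ := by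
    intro ε
    filter_upwards [hcM2] with x hx l
    exact norm_sum_mul_le _ _ hM (fun k => (hx k l).1) fun k => PiLp.norm_apply_le _ k
  have hXb : ∀ ε, 0 < ε → ∀ᵐ x ∂(lebOn Ω), ∀ l,
      ‖X ε l x‖ ≤ d * M * ‖z x‖ + d * M * (3 * ‖zz l x‖) := by
    intro ε hε
    filter_upwards [hcM2] with x hx l
    simp only [X, Finset.sum_add_distrib]
    refine (norm_add_le _ _).trans (add_le_add ?_ ?_)
    · exact norm_sum_mul_le _ _ hM (fun k => (hx k l).2) fun k =>
        (PiLp.norm_apply_le _ k).trans (norm_truncFun_le hε.le _)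
    · exact norm_sum_mul_le _ _ hM (fun k => (hx k l).1) fun k =>
        (PiLp.norm_apply_le _ k).trans (norm_truncDeriv_le hε.le _ _)
  have hYl : ∀ l, MemLp (fun x => d * M * ‖z x‖ + d * M * (3 * ‖zz l x‖)) (ENNReal.ofReal p)
      (lebOn Ω) := fun l => (hzL.norm.const_mul _).add (((hzzL l).norm.const_mul 3).const_mul _)
  have hXm : ∀ ε, 0 < ε → ∀ l, AEStronglyMeasurable (X ε l) (lebOn Ω) := fun ε hε l =>
    (hHX ε hε l).2.1.aestronglyMeasurable
  have hXL : ∀ ε, 0 < ε → ∀ l, MemLp (X ε l) (ENNReal.ofReal p) (lebOn Ω) := fun ε hε l =>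
    (hYl l).mono' (hXm ε hε l) ((hXb ε hε).mono fun x hx => hx l)
  have hest : ∀ ε, 0 < ε →
      |(∫ x, -(∑ l, X ε l x) * conj (regFun p δ (u x)) ∂(lebOn Ω)).im| ≤
        K * (∫ x, -(∑ l, X ε l x) * conj (regFun p δ (u x)) ∂(lebOn Ω)).re := by
    intro ε hε
    have ibp := fun l => integral_mul_regFun hp hδ hε (by positivity : 0 ≤ (d : ℝ) * M) hu huL
      (hg l) (hgL l) (hHX ε hε l) (hXL ε hε l) hzL ((hHb ε).mono fun x hx => hx l)
    have e1 : ∫ x, -(∑ l, X ε l x) * conj (regFun p δ (u x)) ∂(lebOn Ω) =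
        ∫ x, ∑ l, H ε l x * conj (regDeriv p δ (u x) (g l x)) ∂(lebOn Ω) := by
      rw [integral_finsetSum _ fun l _ => (ibp l).1]
      simp only [(ibp _).2.2, Finset.sum_neg_distrib, neg_mul, integral_neg, Finset.sum_mul]
      rw [integral_finsetSum _ fun l _ => (ibp l).2.1]
    rw [e1]
    refine abs_im_integral_le (integrable_finsetSum _ fun l _ => (ibp l).1) ?_
    filter_upwards [hpt] with x hx
    -- The truncation factor is a common nonnegative scalar for all components of the gradient, so
    -- the pointwise estimate carries over with the same `K`.
    have e2 : ∑ l, H ε l x * conj (regDeriv p δ (u x) (g l x)) =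
        (((1 + ε * ‖z x‖ ^ 2)⁻¹ : ℝ) : ℂ) * gradForm (Matrix.of fun k l => c k l x)
          (fun k => g k x) fun l => regDeriv p δ (u x) (g l x) := by
      simp only [H, gradForm, Finset.sum_mul, Finset.mul_sum]
      rw [Finset.sum_comm]
      refine Finset.sum_congr rfl fun k _ => Finset.sum_congr rfl fun l _ => ?_
      rw [truncFun, PiLp.smul_apply, hzk, Complex.real_smul, Matrix.of_apply]
      ring
    have hχ : 0 ≤ (1 + ε * ‖z x‖ ^ 2)⁻¹ := by positivity
    rw [e2, Complex.im_ofReal_mul, Complex.re_ofReal_mul, abs_mul, abs_of_nonneg hχ]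
    have := mul_le_mul_of_nonneg_left (hx (u x) fun k => g k x) hχ
    linarith
  set m : RSpace d → ℝ := fun x => ∑ l, (d * M * ‖z x‖ + d * M * (3 * ‖zz l x‖)) + ‖u x‖ with hm
  have hmL : MemLp m (ENNReal.ofReal p) (lebOn Ω) :=
    (memLp_finsetSum _ fun l _ => hYl l).add huL.norm
  have hs0 : ∀ x, 0 ≤ ∑ l, (d * M * ‖z x‖ + d * M * (3 * ‖zz l x‖)) := fun x =>
    Finset.sum_nonneg fun l _ => by positivity
  have hm0 : ∀ x, 0 ≤ m x := fun x => add_nonneg (hs0 x) (norm_nonneg _)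
  have hmp := integrable_rpow_of_memLp hp hmL (Eventually.of_forall hm0)
  let ε' : ℕ → ℝ := fun n => 1 / ((n : ℝ) + 1)
  have hε0 : ∀ n, 0 < ε' n := fun n => by positivity
  -- The limit `ε → 0` is taken in the divergence form, where `X` is bounded in `L^p` independently
  -- of `ε`.
  have hlim : Tendsto (fun n => ∫ x, -(∑ l, X (ε' n) l x) * conj (regFun p δ (u x)) ∂(lebOn Ω))
      atTop (𝓝 (∫ x, f x * conj (regFun p δ (u x)) ∂(lebOn Ω))) := by
    have hGm : AEStronglyMeasurable (fun x => conj (regFun p δ (u x))) (lebOn Ω) := by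
      have : Continuous fun z : ℂ => conj (regFun p δ z) := Complex.continuous_conj.comp
        (continuous_iff_continuousAt.2 fun z => tendsto_regFun tendsto_const_nhds tendsto_id
          (hδ2.imp_left fun h => by positivity))
      exact this.comp_aestronglyMeasurable huL.aestronglyMeasurable
    refine tendsto_integral_of_dominated_convergence (fun x => m x ^ p) (fun n => ?_) hmp
      (fun n => ?_) ?_
    · exact (Finset.aestronglyMeasurable_fun_sum _ fun l _ => hXm _ (hε0 n) l).neg.mul hGm
    · filter_upwards [hXb _ (hε0 n)] with x hx
      rw [norm_mul, Complex.norm_conj, norm_neg]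
      refine le_trans ?_ (mul_rpow_sub_one_le hp (le_add_of_nonneg_right (norm_nonneg (u x)))
        (hm0 x))
      refine mul_le_mul ((norm_sum_le _ _).trans (Finset.sum_le_sum fun l _ => hx l))
        ((norm_regFun_le hp hδ _).trans ?_) (norm_nonneg _) (hs0 x)
      exact Real.rpow_le_rpow (norm_nonneg _) (le_add_of_nonneg_left (hs0 x)) (by linarith)
    · filter_upwards [hf] with x hx
      refine Tendsto.mul ?_ tendsto_const_nhds
      rw [hx, Finset.sum_comm]
      refine (tendsto_finsetSum _ fun l _ => tendsto_finsetSum _ fun k _ => ?_).neg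
      have hev : ∀ k, Continuous fun v : EuclideanSpace ℂ (Fin d) => v k := fun k => by fun_prop
      have t1 := ((hev k).tendsto _).comp (tendsto_truncFun (z x))
      have t2 := ((hev k).tendsto _).comp (tendsto_truncDeriv (z x) (zz l x))
      rw [hzk] at t1
      rw [hzzk] at t2
      exact (t1.const_mul _).add (t2.const_mul _)
  exact le_of_tendsto_of_tendsto ((Complex.continuous_im.tendsto _).comp hlim).abs
    (((Complex.continuous_re.tendsto _).comp hlim).const_mul K)
    (Eventually.of_forall fun n => hest _ (hε0 n))

theorem integrable_mul_conj_regFun_bound {p : ℝ} (hp : 1 < p) {u f : RSpace d → ℂ}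
    (hu : MemLp u (ENNReal.ofReal p) (lebOn Ω)) (hf : MemLp f (ENNReal.ofReal p) (lebOn Ω)) :
    Integrable (fun x => (‖f x‖ + ‖u x‖) ^ p) (lebOn Ω) ∧
      ∀ δ, (p ≤ 2 ∧ 0 < δ ∨ 2 ≤ p ∧ δ = 0) → ∀ x,
        ‖f x * conj (regFun p δ (u x))‖ ≤ (‖f x‖ + ‖u x‖) ^ p := by
  refine ⟨integrable_rpow_of_memLp hp (hf.norm.add hu.norm)
    (Eventually.of_forall fun x => add_nonneg (norm_nonneg _) (norm_nonneg _)), fun δ hδ x => ?_⟩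
  rw [norm_mul, Complex.norm_conj]
  refine le_trans ?_ (mul_rpow_sub_one_le hp (le_add_of_nonneg_right (norm_nonneg (u x)))
    (by positivity))
  refine mul_le_mul_of_nonneg_left ((norm_regFun_le hp hδ _).trans ?_) (norm_nonneg _)
  exact Real.rpow_le_rpow (norm_nonneg _) (le_add_of_nonneg_left (norm_nonneg _)) (by linarith)

/-- Passing to the limit `δ → 0` in the regularized duality map. -/
theorem sectorial_dualFun {p K : ℝ} (hp : 1 < p) {u f : RSpace d → ℂ}
    (hu : MemLp u (ENNReal.ofReal p) (lebOn Ω)) (hf : MemLp f (ENNReal.ofReal p) (lebOn Ω))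
    (h : ∀ δ, (p ≤ 2 ∧ 0 < δ ∨ 2 ≤ p ∧ δ = 0) →
      |(∫ x, f x * conj (regFun p δ (u x)) ∂(lebOn Ω)).im| ≤
      K * (∫ x, f x * conj (regFun p δ (u x)) ∂(lebOn Ω)).re) :
    Integrable (fun x => f x * conj (dualFun p u x)) (lebOn Ω) ∧
      |(pairing Ω f (dualFun p u)).im| ≤ K * (pairing Ω f (dualFun p u)).re := by
  -- For `p ≥ 2` the constant sequence zero serves. For `p ≤ 2` convergence at `z = 0` is trivial,
  -- since every `regFun` vanishes there.
  obtain ⟨δ', hδ', hlim⟩ : ∃ δ' : ℕ → ℝ, (∀ n, p ≤ 2 ∧ 0 < δ' n ∨ 2 ≤ p ∧ δ' n = 0) ∧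
      ∀ z, Tendsto (fun n => regFun p (δ' n) z) atTop (𝓝 (regFun p 0 z)) := by
    rcases le_total p 2 with h2 | h2
    · refine ⟨fun n => 1 / ((n : ℝ) + 1), fun n => Or.inl ⟨h2, by positivity⟩, fun z => ?_⟩
      rcases eq_or_ne z 0 with rfl | hz
      · simpa only [regFun_zero_right] using tendsto_const_nhds
      · exact tendsto_regFun tendsto_one_div_add_atTop_nhds_zero_nat tendsto_const_nhds
          (Or.inl (by have := norm_pos_iff.2 hz; positivity))
    · exact ⟨fun _ => 0, fun _ => Or.inr ⟨h2, rfl⟩, fun z => tendsto_const_nhds⟩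
  obtain ⟨hb, hb'⟩ := integrable_mul_conj_regFun_bound hp hu hf
  have hδ0 : ∀ n, 0 ≤ δ' n := fun n => by rcases hδ' n with h | h <;> linarith [h.2]
  have hmeas : ∀ n, AEStronglyMeasurable (fun x => f x * conj (regFun p (δ' n) (u x)))
      (lebOn Ω) := by
    intro n
    have : Continuous fun z : ℂ => conj (regFun p (δ' n) z) := Complex.continuous_conj.comp
      (continuous_iff_continuousAt.2 fun z => tendsto_regFun tendsto_const_nhds tendsto_id
        ((hδ' n).imp (fun h => by have := h.2; positivity) And.left))
    exact hf.aestronglyMeasurable.mul (this.comp_aestronglyMeasurable hu.aestronglyMeasurable)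
  have hpt : ∀ x, Tendsto (fun n => f x * conj (regFun p (δ' n) (u x))) atTop
      (𝓝 (f x * conj (dualFun p u x))) := by
    intro x
    rw [← regFun_zero_eq_dualFun]
    exact tendsto_const_nhds.mul ((Complex.continuous_conj.tendsto _).comp (hlim (u x)))
  have ht := tendsto_integral_of_dominated_convergence _ hmeas hb
    (fun n => Eventually.of_forall (hb' _ (hδ' n))) (Eventually.of_forall hpt)
  refine ⟨hb.mono' (aestronglyMeasurable_of_tendsto_ae atTop hmeas (Eventually.of_forall hpt))
    (Eventually.of_forall fun x => le_of_tendsto (hpt x).norm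
      (Eventually.of_forall fun n => hb' _ (hδ' n) x)), ?_⟩
  exact le_of_tendsto_of_tendsto ((Complex.continuous_im.tendsto _).comp ht).abs
    (((Complex.continuous_re.tendsto _).comp ht).const_mul K)
    (Eventually.of_forall fun n => h _ (hδ' n))

/-- Uniform bounds for the coefficients and their weak derivatives. -/
theorem exists_coefficient_derivatives {C : RSpace d → Matrix (Fin d) (Fin d) ℂ}
    (hC : ∀ k l : Fin d, MemW Ω ⊤ 1 (fun x => C x k l)) :
    ∃ (c' : Fin d → Fin d → RSpace d → ℂ) (M : ℝ), 0 ≤ M ∧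
      (∀ k l, IsWeakPartial Ω l (fun x => C x k l) (c' k l)) ∧
      (∀ k l, AEStronglyMeasurable (c' k l) (lebOn Ω)) ∧
      (∀ k l, ∀ᵐ x ∂(lebOn Ω), ‖C x k l‖ ≤ M) ∧ (∀ k l, ∀ᵐ x ∂(lebOn Ω), ‖c' k l x‖ ≤ M) := by
  choose c' hc' hcL using fun k l => (hC k l).2 l
  choose M₁ hM₁ hb₁ using fun k l => exists_bound_of_memLp_top (hC k l).1
  choose M₂ hM₂ hb₂ using fun k l => exists_bound_of_memLp_top (hcL k l)
  have hle : ∀ k l, M₁ k l + M₂ k l ≤ ∑ k, ∑ l, (M₁ k l + M₂ k l) := fun k l =>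
    (Finset.single_le_sum (f := fun l => M₁ k l + M₂ k l)
      (fun l _ => add_nonneg (hM₁ k l) (hM₂ k l)) (Finset.mem_univ l)).trans
    (Finset.single_le_sum (f := fun k => ∑ l, (M₁ k l + M₂ k l))
      (fun k _ => Finset.sum_nonneg fun l _ => add_nonneg (hM₁ k l) (hM₂ k l))
      (Finset.mem_univ k))
  refine ⟨c', ∑ k, ∑ l, (M₁ k l + M₂ k l), Finset.sum_nonneg fun k _ => Finset.sum_nonneg fun l _ =>
    add_nonneg (hM₁ k l) (hM₂ k l), hc', fun k l => (hcL k l).1, fun k l => ?_, fun k l => ?_⟩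
  · filter_upwards [hb₁ k l] with x hx
    linarith [hle k l, hM₂ k l]
  · filter_upwards [hb₂ k l] with x hx
    linarith [hle k l, hM₁ k l]

/-- By the product rule, `∂_l (c_{kl} ∂_k u) = (∂_l c_{kl}) ∂_k u + c_{kl} ∂_l ∂_k u`, a sum of
products of bounded functions with `L_p` functions. -/
theorem exists_isApplyA {p : ℝ} {C : RSpace d → Matrix (Fin d) (Fin d) ℂ}
    (hC : ∀ k l : Fin d, MemW Ω ⊤ 1 (fun x => C x k l)) {u : RSpace d → ℂ}
    (hu : MemDomain Ω p u) : ∃ f : RSpace d → ℂ, IsApplyA Ω p C u f := by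
  obtain ⟨c', M, hM, hc', hcm, hb, hb'⟩ := exists_coefficient_derivatives hC
  choose g hg hgW using hu.1.2
  choose gg hgg hggL using fun k => (hgW k).2
  have hmul : ∀ {a b : RSpace d → ℂ}, AEStronglyMeasurable a (lebOn Ω) →
      (∀ᵐ x ∂(lebOn Ω), ‖a x‖ ≤ M) → MemLp b (ENNReal.ofReal p) (lebOn Ω) →
      MemLp (fun x => a x * b x) (ENNReal.ofReal p) (lebOn Ω) := by
    intro a b ha haM hb
    refine hb.of_le_mul (c := M) (ha.mul hb.aestronglyMeasurable) ?_
    filter_upwards [haM] with x hx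
    rw [norm_mul]
    exact mul_le_mul_of_nonneg_right hx (norm_nonneg _)
  refine ⟨fun x => -∑ k, ∑ l, (c' k l x * g k x + C x k l * gg k l x), hu, ?_, g, _, hg,
    fun k l => (hc' k l).mul_of_bounded (hgg k l) (hb k l) (hb' k l) hM,
    Eventually.of_forall fun x => rfl⟩
  exact (memLp_finsetSum _ fun k _ => memLp_finsetSum _ fun l _ =>
    (hmul (hcm k l) (hb' k l) (hgW k).1).add (hmul (hC k l).1.1 (hb k l) (hggL k l))).neg

theorem sectorialEstimate_of_pointwise {p K : ℝ} (hp : 1 < p)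
    {C : RSpace d → Matrix (Fin d) (Fin d) ℂ}
    (hC : ∀ k l : Fin d, MemW Ω ⊤ 1 (fun x => C x k l))
    (hpt : ∀ᵐ x ∂(lebOn Ω), ∀ (δ : ℝ), 0 ≤ δ → ∀ (z : ℂ) (w : Fin d → ℂ),
      |(gradForm (C x) w fun l => regDeriv p δ z (w l)).im| ≤
        K * (gradForm (C x) w fun l => regDeriv p δ z (w l)).re) :
    SectorialEstimate Ω p C K := by
  rintro u f ⟨hu, hfL, g₀, h, hg₀, hh, hf⟩
  obtain ⟨c', M, hM, hc', -, hb, hb'⟩ := exists_coefficient_derivatives hC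
  choose g hg hgW using hu.1.2
  choose gg hgg hggL using fun k => (hgW k).2
  -- The weak derivatives witnessing `IsApplyA` are arbitrary; uniqueness identifies them with those
  -- given by the product rule.
  have heq : ∀ k l, ∀ᵐ x ∂(lebOn Ω), h k l x = c' k l x * g k x + C x k l * gg k l x := by
    intro k l
    refine IsWeakPartial.ae_eq ((hh k l).congr_left (f' := fun x => C x k l * g k x) ?_)
      ((hc' k l).mul_of_bounded (hgg k l) (hb k l) (hb' k l) hM)
    filter_upwards [(hg₀ k).ae_eq (hg k)] with x hx
    rw [hx]
  refine sectorial_dualFun hp hu.1.1 hfL fun δ hδ => ?_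
  refine sectorial_regFun hp hδ hM hc' hb hb' hu.2 hu.1.1 hg (fun k => (hgW k).1) hgg hggL ?_ ?_
  · filter_upwards [hpt] with x hx
    exact hx δ (by rcases hδ with h | h <;> linarith [h.2])
  · filter_upwards [hf, ae_all_iff.2 fun k => ae_all_iff.2 (heq k)] with x h1 h2
    rw [h1]
    simp only [h2]

end SectorialEstimates

theorem theorem1p2 (d : ℕ) (hd : 0 < d) (Ω : TopologicalSpace.Opens (RSpace d))
    (hΩ : HasLipschitzBoundary Ω)
    (θ : ℝ) (hθ0 : 0 ≤ θ) (hθ : θ < Real.pi / 2)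
    (C : RSpace d → Matrix (Fin d) (Fin d) ℂ)
    (hC : ∀ k l : Fin d, MemW Ω ⊤ 1 (fun x => C x k l))
    (hsector : ∀ᵐ x ∂(lebOn Ω), ∀ ξ : Fin d → ℂ, matrixForm (C x) ξ ∈ complexSector θ)
    (p : ℝ) (hp : 1 < p)
    (hpθ : |1 - 2 / p| < Real.cos θ)
    (hBa : ∀ᵐ x ∂(lebOn Ω), imAntisymm (C x) = 0)
    (φ : ℝ) (hφ : φ = Real.arccos |1 - 2 / p|) :
    (∀ u : RSpace d → ℂ, MemDomain Ω p u → ∃ f : RSpace d → ℂ, IsApplyA Ω p C u f) ∧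
    ((∀ᵐ x ∂(lebOn Ω), reAntisymm (C x) = 0) →
      SectorialEstimate Ω p C (Real.tan (Real.pi / 2 - φ + θ))) ∧
    (¬ (∀ᵐ x ∂(lebOn Ω), reAntisymm (C x) = 0) →
      SectorialEstimate Ω p C
        (((2 / Real.sin φ - 1) * Real.tan θ + Real.cot φ) /
          (1 - Real.tan θ * Real.cot φ))) := by
  obtain ⟨hθφ, hφ2, -, -⟩ := arccos_relations hp hθ0 hθ hpθ hφ
  refine ⟨fun u hu => exists_isApplyA hC hu, fun hRa => ?_, fun _ => ?_⟩
  · refine sectorialEstimate_of_pointwise hp hC ?_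
    filter_upwards [hsector, hBa, hRa] with x hs hB hR δ hδ z w
    exact gradForm_regDeriv_bound hδ
      (gradForm_self_bound hθ hθ0 hs (tan_le_tan_symm_constant hθ0 hθφ hφ2))
      (gradForm_bound_symm hp hθ0 hθ hpθ hφ hs hB hR) z w
  · refine sectorialEstimate_of_pointwise hp hC ?_
    filter_upwards [hsector, hBa] with x hs hB δ hδ z w
    exact gradForm_regDeriv_bound hδ
      (gradForm_self_bound hθ hθ0 hs (tan_le_general_constant hθ0 hθφ hφ2))
      (gradForm_bound_general hp hθ0 hθ hpθ hφ hs hB) z w
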